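/- All graphs are finite and simple. **Zero-visibility cop number.** $k$ cops choose starting vertices of $G$, and at each turn every cop stays put or moves along an edge. Let $P_t$ be the set of vertices occupied after turn $t$, let $R_0=V_G$, $S_t=R_t\setminus P_t$ and $R_{t+1}=(N(S_t)\cup S_t)\setminus P_t$, where $N(S)$ is the set of vertices outside $S$ with a neighbour in $S$. The cops clear $G$ if $S_t=\emptyset$ for some $t$; $c_0(G)$ is the least number of cops that can clear $G$. **Lion number.** $k$ lions move in the same way. Let $L_t$ be the set of vertices occupied at time $t$, and let $\pi_t$ be the set of pairs $(u,v)$ such that some lion goes from $u$ to $v$ at time step $t$. Put $W_0=V_G\setminus L_0$ and $$W_t=(W_{t-1}\setminus L_t)\cup\{v\in V_G\setminus L_t : \exists\, w\in W_{t-1}\cap N(v),\ (v,w)\notin\pi_t \text{ and } (w,v)\notin\pi_t\}.$$ The lions clear $G$ if $W_t=\emptyset$ for some $t$; $\mathcal L(G)$ is the least number of lions that can clear $G$. **The graphs.** Let $t_1=1$ and $t_{i+1}=4t_i+15$. Let $T_1$ be the tree consisting of a root and two leaves. For $i\ge 1$, $T_{i+1}$ is obtained from two disjoint copies of $T_i$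 by adding a new root and joining it to the root of each copy by a path with $t_i+5$ internal vertices. Let $G_i$ be $T_i$ together with a new vertex adjacent to all vertices of $T_i$. **Corollary.** The zero-visibility cop number is not monotone under subgraph inclusion, even for connected graphs: there are a connected graph $G$ and a connected subgraph $H$ of $G$ with $c_0(H)>c_0(G)$. More precisely, $c_0(G)\le\mathcal L(G)$ for every graph $G$; for every $i\ge 1$, $T_i$ is a tree, $T_i$ is (isomorphic to) a subgraph of $G_i$, $\mathcal L(G_i)\le 3$ and hence $c_0(G_i)\le 3$; while $c_0(T_i)\ge 4$ for every $i\ge 13$. -/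

import Mathlib

/-! ### Neighbourhoods and token walks -/

/-- The open neighbourhood `N(S)`: the vertices outside `S` with a neighbour in `S`. -/
def openNeighborhood {V : Type*} (G : SimpleGraph V) (S : Set V) : Set V :=
  {w | w ∉ S ∧ ∃ v ∈ S, G.Adj w v}

/-- `k` tokens (cops or lions) walk on `G`: `p t i` is the position of token `i` at time `t`. The
starting positions are arbitrary, several tokens may share a vertex, and at every time step every
token independently stays where it is or moves along an edge. -/
def IsTokenWalk {V : Type*} (G : SimpleGraph V) {k : ℕ} (p : ℕ → Fin k → V) : Prop :=
  ∀ (t : ℕ) (i : Fin k), p (t + 1) i = p t i ∨ G.Adj (p t i) (p (t + 1) i)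

/-- The set of vertices occupied at time `t`. -/
def occupied {V : Type*} {k : ℕ} (p : ℕ → Fin k → V) (t : ℕ) : Set V :=
  Set.range (p t)

/-! ### Zero-visibility Cops and Robber -/

/-- `dirtyBefore G p t` is the set `R_t` of vertices that may hold the robber immediately before
the `t`-th turn of the cops; turn `0` is the initial placement of the cops. With `S_t = R_t \ P_t`,
where `P_t` is the set of occupied vertices, `R_{t+1} = (N(S_t) ∪ S_t) \ P_t`. -/
def dirtyBefore {V : Type*} (G : SimpleGraph V) {k : ℕ} (p : ℕ → Fin k → V) : ℕ → Set V
  | 0 => Set.univ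
  | t + 1 => (openNeighborhood G (dirtyBefore G p t \ occupied p t) ∪
      (dirtyBefore G p t \ occupied p t)) \ occupied p t

/-- `dirtyAfter G p t` is the set `S_t = R_t \ P_t` of vertices that may hold the robber
immediately after the `t`-th turn of the cops. -/
def dirtyAfter {V : Type*} (G : SimpleGraph V) {k : ℕ} (p : ℕ → Fin k → V) (t : ℕ) : Set V :=
  dirtyBefore G p t \ occupied p t

/-- `k` cops can clear `G` in the zero-visibility game. -/
def CopClearable {V : Type*} (G : SimpleGraph V) (k : ℕ) : Prop :=
  ∃ p : ℕ → Fin k → V, IsTokenWalk G p ∧ ∃ t, dirtyAfter G p t = ∅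

/-- The zero-visibility cop number `c₀(G)` of a finite graph. -/
noncomputable def zeroVisibilityCopNumber {V : Type*} [Finite V] (G : SimpleGraph V) : ℕ :=
  sInf {k | CopClearable G k}

/-! ### Lions and contamination -/

/-- The pairs `(u, v)` such that some lion goes from `u` to `v` between times `t` and `t + 1`. -/
def lionMoves {V : Type*} {k : ℕ} (p : ℕ → Fin k → V) (t : ℕ) : Set (V × V) :=
  {e | ∃ i : Fin k, e = (p t i, p (t + 1) i)}

/-- The set of contaminated vertices at time `t`. -/
def contaminated {V : Type*} (G : SimpleGraph V) {k : ℕ} (p : ℕ → Fin k → V) : ℕ → Set V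
  | 0 => (occupied p 0)ᶜ
  | t + 1 => (contaminated G p t \ occupied p (t + 1)) ∪
      {v | v ∉ occupied p (t + 1) ∧ ∃ w ∈ contaminated G p t, G.Adj v w ∧
        (v, w) ∉ lionMoves p t ∧ (w, v) ∉ lionMoves p t}

/-- `k` lions can clear `G`. -/
def LionClearable {V : Type*} (G : SimpleGraph V) (k : ℕ) : Prop :=
  ∃ p : ℕ → Fin k → V, IsTokenWalk G p ∧ ∃ t, contaminated G p t = ∅

/-- The lion number `𝓛(G)` of a finite graph. -/
noncomputable def lionNumber {V : Type*} [Finite V] (G : SimpleGraph V) : ℕ :=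
  sInf {k | LionClearable G k}

/-! ### The trees `T_i` and the graphs `G_i` -/

/-- Vertices of the graph obtained from two disjoint copies of a rooted graph on `V` by joining a
new root to the roots of the copies by two paths with `m` internal vertices each. -/
inductive JoinVertex (V : Type) (m : ℕ) : Type
  | root : JoinVertex V m
  | path (b : Bool) (j : Fin m) : JoinVertex V m
  | copy (b : Bool) (v : V) : JoinVertex V m

/-- The vertex at distance `j` from the new root on the path from the new root (`j = 0`) to the
root `r` of the copy number `b` (`j = m + 1`). -/
def armVertex {V : Type} (r : V) (m : ℕ) (b : Bool) (j : ℕ) : JoinVertex V m :=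
  if h₀ : j = 0 then .root
  else if h : j ≤ m then .path b ⟨j - 1, by omega⟩
  else .copy b r

/-- Two disjoint copies of `G`, rooted at `r`, whose roots are joined to a new root by paths with
`m` internal vertices. -/
def joinGraph {V : Type} (G : SimpleGraph V) (r : V) (m : ℕ) : SimpleGraph (JoinVertex V m) :=
  SimpleGraph.fromRel fun x y =>
    (∃ b v w, G.Adj v w ∧ x = .copy b v ∧ y = .copy b w) ∨
    (∃ b j, j ≤ m ∧ x = armVertex r m b j ∧ y = armVertex r m b (j + 1))

/-- The numbers `t_i`: `t_1 = 1` and `t_{i+1} = 4 t_i + 15`. The value at `0` is not used. -/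
def stepCount : ℕ → ℕ
  | 0 => 0
  | 1 => 1
  | i + 2 => 4 * stepCount (i + 1) + 15

/-- The number of internal vertices on each of the two paths below the root of `T_{i+1}`: it is
`t_i + 5` for `i ≥ 1`, and `0` for `i = 0`. -/
def internalCount : ℕ → ℕ
  | 0 => 0
  | i + 1 => stepCount (i + 1) + 5

/-- The vertices of `T_i`. -/
def TreeVertex : ℕ → Type
  | 0 => Unit
  | i + 1 => JoinVertex (TreeVertex i) (internalCount i)

/-- The root of `T_i`. -/
def treeRoot : (i : ℕ) → TreeVertex i
  | 0 => ()
  | _ + 1 => JoinVertex.root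

/-- The tree `T_i`. By convention `T_0` is a single vertex, so that `T_1` is a root with two
leaves. -/
def treeGraph : (i : ℕ) → SimpleGraph (TreeVertex i)
  | 0 => ⊥
  | i + 1 => joinGraph (treeGraph i) (treeRoot i) (internalCount i)

/-- The graph obtained from `G` by adding a universal vertex `none`. -/
def addUniversal {V : Type} (G : SimpleGraph V) : SimpleGraph (Option V) :=
  SimpleGraph.fromRel fun x y =>
    x = none ∨ ∃ v w, G.Adj v w ∧ x = some v ∧ y = some w

/-- The graph `G_i`: the tree `T_i` with a universal vertex added. -/
def coneGraph (i : ℕ) : SimpleGraph (Option (TreeVertex i)) :=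
  addUniversal (treeGraph i)

instance instFiniteJoinVertex (V : Type) [Finite V] (m : ℕ) : Finite (JoinVertex V m) := by
  refine Finite.of_injective
    (β := Option ((Bool × Fin m) ⊕ (Bool × V)))
    (fun x => match x with
      | .root => none
      | .path b j => some (.inl (b, j))
      | .copy b v => some (.inr (b, v))) ?_
  rintro (_ | _ | _) (_ | _ | _) h <;> simp_all

instance instFiniteTreeVertex : (i : ℕ) → Finite (TreeVertex i)
  | 0 => inferInstanceAs (Finite Unit)
  | i + 1 =>
    haveI := instFiniteTreeVertex i
    inferInstanceAs (Finite (JoinVertex (TreeVertex i) (internalCount i)))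

/-! ### Adjacency in a join of two rooted copies -/

section Join

variable {V : Type} {G : SimpleGraph V} {r : V} {m : ℕ}

/-! Lower bound. Suppose `k` cops cannot clear `T`, and a connected graph contains four copies of
`T`, hung in pairs by long paths on two vertices. Then `k + 1` cops cannot clear it. Indeed, a copy
attached only at its root that goes from entirely dirty to clean must at some moment hold all the
cops: otherwise some cop is always outside, and the others, retracted onto the copy, would clear it
(`RootedPart.exists_all_inside`). Call a copy threatened if some dirty vertex is so much closer to
its root than all cops that the copy is bound to become entirely dirty, and unsafe if it has a dirty
vertex or is threatened. Take the first time at which each pair has a safe copy, and the last visits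
of all cops to these two copies. At the later visit the copy `X` visited earlier is not threatened.
As all cops are far away in one copy, both `X` and the sibling `Y` of the visited copy are then
safe, since otherwise `X` would be threatened. But no cop was in `X` or `Y` just before, so one step
earlier both were safe already, a contradiction (`not_copClearable_of_four_parts`). Every two levels
of the trees thus cost one more cop.

Upper bound. On a cone, a lion at the universal vertex lets another lion jump: it steps down to the
target while the jumper steps up. So three lions simulate two lions on the tree, one of which may
jump while the other stays (`LionsAt.exists_step`). Recording both ends of the trajectories of
uncaught evaders makes this game reversible in time (`Sweep.symm`). To clear the tree, sweep one
branch backwards, ending at the root, and then the other branch forwards. A branch is swept by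
recursion (`branchSweepable_join`): its arm is too long for an evader to escape during the sweep of
a sub-branch.

Finally `c₀ ≤ 𝓛` because the same walk leaves fewer vertices dirty than contaminated. -/

@[simp] lemma armVertex_zero (b : Bool) : armVertex r m b 0 = .root := by simp [armVertex]

lemma armVertex_succ (b : Bool) (j : Fin m) : armVertex r m b (j + 1) = .path b j := by
  have := j.2
  simp [armVertex]

lemma armVertex_last (b : Bool) : armVertex r m b (m + 1) = .copy b r := by simp [armVertex]

lemma armVertex_eq_root_iff {b : Bool} {j : ℕ} : armVertex r m b j = .root ↔ j = 0 := by
  unfold armVertex; split_ifs <;> simp_all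

lemma armVertex_eq_path_iff {b b' : Bool} {j : ℕ} {k : Fin m} :
    armVertex r m b j = .path b' k ↔ b = b' ∧ j = k + 1 := by
  have := k.2
  unfold armVertex
  split_ifs with h h'
  · simp [h]
  · simp only [JoinVertex.path.injEq, Fin.ext_iff]
    exact and_congr_right fun _ => by omega
  · exact iff_of_false (by simp) (by omega)

lemma armVertex_eq_copy_iff {b b' : Bool} {j : ℕ} {x : V} :
    armVertex r m b j = .copy b' x ↔ b = b' ∧ m < j ∧ x = r := by
  unfold armVertex
  split_ifs with h h'
  · exact iff_of_false (by simp) (by omega)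
  · exact iff_of_false (by simp) (by omega)
  · simp only [JoinVertex.copy.injEq]; constructor
    · rintro ⟨h, h'⟩; exact ⟨h, by omega, h'.symm⟩
    · rintro ⟨h, _, h'⟩; exact ⟨h, h'.symm⟩

lemma joinGraph_adj_copy {b : Bool} {x : V} {w : JoinVertex V m} :
    (joinGraph G r m).Adj (.copy b x) w ↔
      (∃ y, G.Adj x y ∧ w = .copy b y) ∨ (x = r ∧ w = armVertex r m b m) := by
  simp only [joinGraph, SimpleGraph.fromRel_adj]
  constructor
  · rintro ⟨-, (⟨b', y, z, h, h1, h2⟩ | ⟨b', j, h, h1, h2⟩) |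
      (⟨b', y, z, h, h1, h2⟩ | ⟨b', j, h, h1, h2⟩)⟩
    · simp only [JoinVertex.copy.injEq] at h1
      obtain ⟨rfl, rfl⟩ := h1
      exact .inl ⟨z, h, h2⟩
    · rw [eq_comm, armVertex_eq_copy_iff] at h1; omega
    · simp only [JoinVertex.copy.injEq] at h2
      obtain ⟨rfl, rfl⟩ := h2
      exact .inl ⟨y, h.symm, h1⟩
    · rw [eq_comm, armVertex_eq_copy_iff] at h2
      obtain ⟨rfl, h2, rfl⟩ := h2
      obtain rfl : j = m := by omega
      exact .inr ⟨rfl, h1⟩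
  · rintro (⟨y, h, rfl⟩ | ⟨rfl, rfl⟩)
    · exact ⟨by simpa using h.ne, .inl (.inl ⟨b, x, y, h, rfl, rfl⟩)⟩
    · refine ⟨?_, .inr (.inr ⟨b, m, le_rfl, rfl, (armVertex_last b).symm⟩)⟩
      rw [ne_eq, eq_comm, armVertex_eq_copy_iff]; omega

lemma joinGraph_adj_root {w : JoinVertex V m} :
    (joinGraph G r m).Adj .root w ↔ ∃ b, w = armVertex r m b 1 := by
  simp only [joinGraph, SimpleGraph.fromRel_adj]
  constructor
  · rintro ⟨-, (⟨b', y, z, h, h1, h2⟩ | ⟨b', j, h, h1, h2⟩) |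
      (⟨b', y, z, h, h1, h2⟩ | ⟨b', j, h, h1, h2⟩)⟩
    · cases h1
    · rw [eq_comm, armVertex_eq_root_iff] at h1
      subst h1
      exact ⟨b', h2⟩
    · cases h2
    · rw [eq_comm, armVertex_eq_root_iff] at h2; omega
  · rintro ⟨b, rfl⟩
    refine ⟨?_, .inl (.inr ⟨b, 0, by omega, by simp, rfl⟩)⟩
    rw [ne_eq, eq_comm, armVertex_eq_root_iff]; omega

lemma joinGraph_adj_path {b : Bool} {j : Fin m} {w : JoinVertex V m} :
    (joinGraph G r m).Adj (.path b j) w ↔ w = armVertex r m b j ∨ w = armVertex r m b (j + 2) := by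
  have := j.2
  simp only [joinGraph, SimpleGraph.fromRel_adj]
  constructor
  · rintro ⟨-, (⟨b', y, z, h, h1, h2⟩ | ⟨b', k, h, h1, h2⟩) |
      (⟨b', y, z, h, h1, h2⟩ | ⟨b', k, h, h1, h2⟩)⟩
    · cases h1
    · rw [eq_comm, armVertex_eq_path_iff] at h1
      obtain ⟨rfl, rfl⟩ := h1
      exact .inr h2
    · cases h2
    · rw [eq_comm, armVertex_eq_path_iff] at h2
      obtain ⟨rfl, h2⟩ := h2
      obtain rfl : k = j := by omega
      exact .inl h1
  · rintro (rfl | rfl)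
    · refine ⟨?_, .inr (.inr ⟨b, j, by omega, rfl, (armVertex_succ b j).symm⟩)⟩
      rw [ne_eq, eq_comm, armVertex_eq_path_iff]; omega
    · refine ⟨?_, .inl (.inr ⟨b, j + 1, by omega, (armVertex_succ b j).symm, rfl⟩)⟩
      rw [ne_eq, eq_comm, armVertex_eq_path_iff]; omega

lemma joinGraph_adj_copy_copy {b b' : Bool} {x y : V} :
    (joinGraph G r m).Adj (.copy b x) (.copy b' y) ↔ b = b' ∧ G.Adj x y := by
  rw [joinGraph_adj_copy]
  constructor
  · rintro (⟨z, h, h'⟩ | ⟨-, h⟩)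
    · simp only [JoinVertex.copy.injEq] at h'
      obtain ⟨rfl, rfl⟩ := h'
      exact ⟨rfl, h⟩
    · rw [eq_comm, armVertex_eq_copy_iff] at h; omega
  · rintro ⟨rfl, h⟩
    exact .inl ⟨y, h, rfl⟩

lemma joinGraph_adj_arm {b : Bool} {j : ℕ} (hj : j < m) {w : JoinVertex V m} :
    (joinGraph G r m).Adj (armVertex r m b (j + 1)) w ↔
      w = armVertex r m b j ∨ w = armVertex r m b (j + 2) := by
  rw [show armVertex r m b (j + 1) = .path b ⟨j, hj⟩ from armVertex_succ b ⟨j, hj⟩]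
  exact joinGraph_adj_path

lemma joinGraph_adj_arm_succ (b : Bool) {j : ℕ} (hj : j ≤ m) :
    (joinGraph G r m).Adj (armVertex r m b j) (armVertex r m b (j + 1)) := by
  rcases j with _ | j
  · rw [armVertex_zero]; exact joinGraph_adj_root.2 ⟨b, rfl⟩
  · rw [joinGraph_adj_arm hj]; exact .inr rfl

end Join

/-! ### Depth functions -/

/-- `h` is the distance from `r` in a tree. -/
structure IsDepth {V : Type*} (G : SimpleGraph V) (r : V) (h : V → ℕ) : Prop where
  root : h r = 0
  adj : ∀ x y, G.Adj x y → h x = h y + 1 ∨ h y = h x + 1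
  parent : ∀ x, x ≠ r → ∃ y, G.Adj x y ∧ h x = h y + 1
  unique : ∀ x y z, G.Adj x y → G.Adj x z → h x = h y + 1 → h x = h z + 1 → y = z

namespace IsDepth

variable {V : Type*} {G : SimpleGraph V} {r : V} {h : V → ℕ}

lemma exists_walk (H : IsDepth G r h) (x : V) : ∃ p : G.Walk x r, p.length = h x := by
  induction hn : h x generalizing x with
  | zero =>
    by_cases hx : x = r
    · subst hx; exact ⟨.nil, rfl⟩
    · obtain ⟨y, -, h2⟩ := H.parent x hx; omega
  | succ n ih =>
    have hx : x ≠ r := by rintro rfl; have := H.root; omega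
    obtain ⟨y, h1, h2⟩ := H.parent x hx
    obtain ⟨p, hp⟩ := ih y (by omega)
    exact ⟨.cons h1 p, by simp [hp]⟩

lemma connected (H : IsDepth G r h) : G.Connected := by
  have key : ∀ x, G.Reachable x r := fun x => (H.exists_walk x).choose.reachable
  exact { preconnected := fun x y => (key x).trans (key y).symm, nonempty := ⟨r⟩ }

/-- A deepest vertex of a cycle would have two distinct neighbours of smaller depth, against
uniqueness of the parent. -/
lemma isAcyclic (H : IsDepth G r h) : G.IsAcyclic := by
  classical
  intro v c hc
  obtain ⟨u, hu, hmax⟩ := c.support.toFinset.exists_max_image h ⟨v, by simp⟩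
  simp only [List.mem_toFinset] at hu hmax
  have hc' := hc.rotate hu
  have hne := hc'.snd_ne_penultimate
  have hs := (c.rotate u hu).adj_snd hc'.not_nil
  have hp := ((c.rotate u hu).adj_penultimate hc'.not_nil).symm
  have mem : ∀ x ∈ (c.rotate u hu).support, h x ≤ h u := fun x hx =>
    hmax x (by simpa using hx)
  have h1 : h (c.rotate u hu).snd ≤ h u := mem _ ((c.rotate u hu).getVert_mem_support 1)
  have h2 : h (c.rotate u hu).penultimate ≤ h u :=
    mem _ ((c.rotate u hu).getVert_mem_support ((c.rotate u hu).length - 1))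
  refine hne (H.unique u _ _ hs hp ?_ ?_)
  · have := H.adj _ _ hs; omega
  · have := H.adj _ _ hp; omega

lemma isTree (H : IsDepth G r h) : G.IsTree := ⟨H.connected, H.isAcyclic⟩

end IsDepth

/-- The depth function of a join. -/
def joinDepth {V : Type} (h : V → ℕ) (m : ℕ) : JoinVertex V m → ℕ
  | .root => 0
  | .path _ j => j + 1
  | .copy _ x => m + 1 + h x

lemma joinDepth_armVertex {V : Type} {h : V → ℕ} {r : V} (hr : h r = 0) {m : ℕ} (b : Bool) {j : ℕ}
    (hj : j ≤ m + 1) : joinDepth h m (armVertex r m b j) = j := by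
  unfold armVertex
  split_ifs with h0 h1
  · simp [joinDepth, h0]
  · simp only [joinDepth]; omega
  · simp only [joinDepth, hr]; omega

lemma isDepth_joinDepth {V : Type} {G : SimpleGraph V} {r : V} {h : V → ℕ} (H : IsDepth G r h)
    (m : ℕ) : IsDepth (joinGraph G r m) .root (joinDepth h m) where
  root := rfl
  adj := by
    rintro (_ | ⟨b, j⟩ | ⟨b, x⟩) y hxy
    · obtain ⟨b, rfl⟩ := joinGraph_adj_root.1 hxy
      rw [joinDepth_armVertex H.root _ (by omega)]
      exact .inr rfl
    · have := j.2
      obtain rfl | rfl := joinGraph_adj_path.1 hxy <;>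
        rw [joinDepth_armVertex H.root _ (by omega)] <;> simp [joinDepth]
    · obtain ⟨z, hz, rfl⟩ | ⟨rfl, rfl⟩ := joinGraph_adj_copy.1 hxy
      · have := H.adj _ _ hz
        simp only [joinDepth]; omega
      · rw [joinDepth_armVertex H.root _ (by omega)]
        simp [joinDepth, H.root]
  parent := by
    rintro (_ | ⟨b, j⟩ | ⟨b, x⟩) hx
    · exact absurd rfl hx
    · have := j.2
      refine ⟨_, joinGraph_adj_path.2 (.inl rfl), ?_⟩
      rw [joinDepth_armVertex H.root _ (by omega)]; rfl
    · by_cases hxr : x = r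
      · refine ⟨_, joinGraph_adj_copy.2 (.inr ⟨hxr, rfl⟩), ?_⟩
        rw [joinDepth_armVertex H.root _ (by omega), hxr]; simp [joinDepth, H.root]
      · obtain ⟨y, h1, h2⟩ := H.parent x hxr
        exact ⟨_, joinGraph_adj_copy.2 (.inl ⟨y, h1, rfl⟩), by simp only [joinDepth]; omega⟩
  unique := by
    rintro (_ | ⟨b, j⟩ | ⟨b, x⟩) y z hy hz h1 h2
    · simp [joinDepth] at h1
    · have := j.2
      obtain rfl | rfl := joinGraph_adj_path.1 hy <;> obtain rfl | rfl := joinGraph_adj_path.1 hz <;>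
        rw [joinDepth_armVertex H.root _ (by omega)] at h1 h2 <;>
        simp only [joinDepth] at h1 h2 <;> first | rfl | omega
    · obtain ⟨y, hy', rfl⟩ | ⟨hy', rfl⟩ := joinGraph_adj_copy.1 hy <;>
        obtain ⟨z, hz', rfl⟩ | ⟨hz', rfl⟩ := joinGraph_adj_copy.1 hz
      · simp only [joinDepth] at h1 h2
        rw [H.unique x y z hy' hz' (by omega) (by omega)]
      · simp only [joinDepth, hz', H.root] at h1; omega
      · simp only [joinDepth, hy', H.root] at h2; omega
      · rfl

/-- The distance from the root in `T_i`. -/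
def treeDepth : (i : ℕ) → TreeVertex i → ℕ
  | 0 => fun _ => 0
  | i + 1 => joinDepth (treeDepth i) (internalCount i)

lemma isDepth_treeDepth : (i : ℕ) → IsDepth (treeGraph i) (treeRoot i) (treeDepth i)
  | 0 => ⟨rfl, fun _ _ h => h.elim, fun _ h => (h rfl).elim, fun _ _ _ _ _ _ _ => rfl⟩
  | i + 1 => isDepth_joinDepth (isDepth_treeDepth i) _

lemma treeGraph_isTree (i : ℕ) : (treeGraph i).IsTree := (isDepth_treeDepth i).isTree

/-- The height of `T_i`. -/
def treeHeight : ℕ → ℕ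
  | 0 => 0
  | i + 1 => internalCount i + 1 + treeHeight i

lemma treeDepth_le : (i : ℕ) → (x : TreeVertex i) → treeDepth i x ≤ treeHeight i
  | 0, _ => le_rfl
  | i + 1, .root => Nat.zero_le _
  | i + 1, .path _ j => by have := j.2; simp only [treeDepth, joinDepth, treeHeight]; omega
  | i + 1, .copy _ x => by
    have := treeDepth_le i x
    simp only [treeDepth, joinDepth, treeHeight]; omega

/-- With `d` this height and arms of length `l = t + 6`, this yields the condition `5 * d + 8 ≤ 2 *
l` that drives the lower bound, with one unit to spare. -/
lemma five_mul_treeHeight_le (i : ℕ) : 5 * treeHeight (i + 1) ≤ 2 * stepCount (i + 1) + 3 := by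
  induction i with
  | zero => simp [treeHeight, internalCount, stepCount]
  | succ i ih =>
    rw [treeHeight, stepCount, internalCount]; omega

/-! ### Rooted parts -/

/-- `φ` embeds `T` into `G`, and the image is attached to the rest of `G` only at `φ r`. -/
structure RootedPart {U V : Type*} (T : SimpleGraph U) (r : U) (G : SimpleGraph V) (φ : U → V) :
    Prop where
  injective : Function.Injective φ
  adj_iff : ∀ x y, G.Adj (φ x) (φ y) ↔ T.Adj x y
  closed : ∀ x w, x ≠ r → G.Adj (φ x) w → ∃ y, w = φ y

lemma RootedPart.refl {V : Type*} (G : SimpleGraph V) (r : V) : RootedPart G r G id :=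
  ⟨Function.injective_id, fun _ _ => Iff.rfl, fun _ w _ _ => ⟨w, rfl⟩⟩

lemma RootedPart.copy {U : Type} {V : Type*} {T : SimpleGraph U} {r : U} {m : ℕ}
    {G : SimpleGraph V} {ψ : JoinVertex U m → V} (H : RootedPart (joinGraph T r m) .root G ψ)
    (b : Bool) : RootedPart T r G (fun x => ψ (.copy b x)) where
  injective x y h := by simpa using H.injective h
  adj_iff x y := by rw [H.adj_iff, joinGraph_adj_copy_copy]; simp
  closed x w hx h := by
    obtain ⟨y, rfl⟩ := H.closed _ _ (by simp) h
    rw [H.adj_iff, joinGraph_adj_copy] at h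
    obtain ⟨z, -, rfl⟩ | ⟨h, -⟩ := h
    · exact ⟨z, rfl⟩
    · exact absurd h hx

/-! ### The zero-visibility game: basic dynamics -/

section Dynamics

variable {V : Type*} {G : SimpleGraph V} {k : ℕ} {p : ℕ → Fin k → V}

lemma mem_dirtyAfter_zero {x : V} (hx : ∀ i, p 0 i ≠ x) : x ∈ dirtyAfter G p 0 :=
  ⟨trivial, fun ⟨i, hi⟩ => hx i hi⟩

/-- The target must be free at both times: `R_{t+1}` already omits the vertices occupied at time
`t`. -/
lemma mem_dirtyAfter_succ {t : ℕ} {x y : V} (hx : x ∈ dirtyAfter G p t) (hxy : y = x ∨ G.Adj y x)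
    (h : ∀ i, p t i ≠ y) (h' : ∀ i, p (t + 1) i ≠ y) : y ∈ dirtyAfter G p (t + 1) := by
  refine ⟨⟨?_, fun ⟨i, hi⟩ => h i hi⟩, fun ⟨i, hi⟩ => h' i hi⟩
  by_cases hy : y ∈ dirtyAfter G p t
  · exact .inr hy
  · rcases hxy with rfl | hxy
    · exact absurd hx hy
    · exact .inl ⟨hy, x, hx, hxy⟩

lemma exists_of_mem_dirtyAfter_succ {t : ℕ} {y : V} (hy : y ∈ dirtyAfter G p (t + 1)) :
    ∃ x ∈ dirtyAfter G p t, y = x ∨ G.Adj y x := by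
  obtain ⟨⟨h | h, -⟩, -⟩ := hy
  · obtain ⟨-, x, hx, hxy⟩ := h
    exact ⟨x, hx, .inr hxy⟩
  · exact ⟨y, h, .inl rfl⟩

/-- A dirty vertex stays dirty as long as no cop visits it. -/
lemma mem_dirtyAfter_of_le {s t : ℕ} {x : V} (hx : x ∈ dirtyAfter G p s) (hst : s ≤ t)
    (h : ∀ u, s ≤ u → u ≤ t → ∀ i, p u i ≠ x) : x ∈ dirtyAfter G p t := by
  induction t, hst using Nat.le_induction with
  | base => exact hx
  | succ t hst ih =>
    exact mem_dirtyAfter_succ (ih fun u h1 h2 => h u h1 (by omega)) (.inl rfl)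
      (h t hst (by omega)) (h (t + 1) (by omega) le_rfl)

lemma IsTokenWalk.lipschitz (hp : IsTokenWalk G p) {f : V → ℤ}
    (hf : ∀ x y, G.Adj x y → f y ≤ f x + 1) (s n : ℕ) (i : Fin k) :
    f (p (s + n) i) ≤ f (p s i) + n ∧ f (p s i) ≤ f (p (s + n) i) + n := by
  induction n with
  | zero => simp
  | succ n ih =>
    rw [← add_assoc]
    push_cast
    obtain h | h := hp (s + n) i
    · rw [h]; omega
    · have h1 := hf _ _ h
      have h2 := hf _ _ h.symm
      omega

end Dynamics

/-! ### Confining cops to a rooted part -/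

section Shadow

variable {U V : Type*} {T : SimpleGraph U} {r : U} {G : SimpleGraph V} {φ : U → V}

open Classical in
/-- The retraction of a graph onto a rooted part. -/
noncomputable def RootedPart.retract (_ : RootedPart T r G φ) (x : V) : U :=
  if h : ∃ y, x = φ y then h.choose else r

lemma RootedPart.retract_apply (H : RootedPart T r G φ) (y : U) : H.retract (φ y) = y := by
  have h : ∃ z, φ y = φ z := ⟨y, rfl⟩
  rw [RootedPart.retract, dif_pos h]
  exact (H.injective h.choose_spec).symm

lemma RootedPart.retract_of_notMem (H : RootedPart T r G φ) {x : V} (hx : ∀ y, x ≠ φ y) :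
    H.retract x = r := by
  rw [RootedPart.retract, dif_neg (by simpa using hx)]

lemma RootedPart.retract_adj (H : RootedPart T r G φ) {x y : V} (h : G.Adj x y) :
    H.retract y = H.retract x ∨ T.Adj (H.retract x) (H.retract y) := by
  by_cases hx : ∃ a, x = φ a
  · obtain ⟨a, rfl⟩ := hx
    by_cases hy : ∃ b, y = φ b
    · obtain ⟨b, rfl⟩ := hy
      rw [H.retract_apply, H.retract_apply]
      exact .inr ((H.adj_iff a b).1 h)
    · rw [H.retract_apply, H.retract_of_notMem (x := y) (by simpa using hy)]
      by_cases ha : a = r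
      · exact .inl ha.symm
      · exact absurd (H.closed a y ha h) hy
  · rw [H.retract_of_notMem (x := x) (by simpa using hx)]
    by_cases hy : ∃ b, y = φ b
    · obtain ⟨b, rfl⟩ := hy
      rw [H.retract_apply]
      by_cases hb : b = r
      · exact .inl hb
      · exact absurd (H.closed b x hb h.symm) hx
    · rw [H.retract_of_notMem (x := y) (by simpa using hy)]
      exact .inl rfl

/-- The only way in is through the root, where the retraction of an outside cop already is. This
makes the exchange of cops in `outsideRelabel` invisible on the part. -/
lemma RootedPart.eq_root_of_enter (H : RootedPart T r G φ) {x y : V} (h : y = x ∨ G.Adj x y)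
    (hx : ∀ a, x ≠ φ a) : H.retract y = r := by
  by_cases hy : ∃ b, y = φ b
  · obtain ⟨b, rfl⟩ := hy
    rw [H.retract_apply]
    by_contra hb
    obtain h | h := h
    · exact hx b h.symm
    · obtain ⟨a, ha⟩ := H.closed b x hb h.symm
      exact hx a ha
  · exact H.retract_of_notMem (by simpa using hy)

open Classical in
/-- Relabelling of `k + 1` cops such that the last one is always outside a given set: it is changed
only when the present last one enters the set. -/
noncomputable def outsideRelabel {k : ℕ} (A : ℕ → Fin (k + 1) → Prop)
    (m : ℕ → Fin (k + 1)) : ℕ → Equiv.Perm (Fin (k + 1))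
  | 0 => Equiv.swap (Fin.last k) (m 0)
  | t + 1 =>
    let σ := outsideRelabel A m t
    if A (t + 1) (σ (Fin.last k)) then Equiv.swap (σ (Fin.last k)) (m (t + 1)) * σ else σ

/-- If `k + 1` cops walk on `G` and never are all in the rooted part, then `k` cops can do at least
as well on the rooted part alone. -/
lemma RootedPart.exists_shadow (H : RootedPart T r G φ) {k : ℕ} {p : ℕ → Fin (k + 1) → V}
    (hp : IsTokenWalk G p) (hout : ∀ t, ∃ i, ∀ x, p t i ≠ φ x) :
    ∃ q : ℕ → Fin k → U, IsTokenWalk T q ∧ ∀ t x, φ x ∈ occupied p t → x ∈ occupied q t := by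
  classical
  choose m hm using hout
  set A : ℕ → Fin (k + 1) → Prop := fun t i => ∃ x, p t i = φ x with hA
  set σ := outsideRelabel A m with hσ
  have hlast : ∀ t, ¬ A t (σ t (Fin.last k)) := by
    intro t
    cases t with
    | zero =>
      simp only [hσ, outsideRelabel, Equiv.swap_apply_left, hA]
      simpa using hm 0
    | succ t =>
      simp only [hσ, outsideRelabel]
      split_ifs with h
      · simp only [Equiv.Perm.mul_apply, Equiv.swap_apply_left, hA]
        simpa using hm (t + 1)
      · exact h
  have hstep : ∀ t (i : Fin k), H.retract (p (t + 1) (σ (t + 1) i.castSucc)) =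
      H.retract (p (t + 1) (σ t i.castSucc)) := by
    intro t i
    have hne : σ t i.castSucc ≠ σ t (Fin.last k) := by
      simp [(Fin.castSucc_lt_last i).ne]
    have hσ' : σ (t + 1) = if A (t + 1) (σ t (Fin.last k)) then
        Equiv.swap (σ t (Fin.last k)) (m (t + 1)) * σ t else σ t := by
      simp only [hσ, outsideRelabel]
    rw [hσ']
    split_ifs with h
    · rw [Equiv.Perm.mul_apply]
      -- Token `i` trades a cop that is outside for the one that has just entered; both retract to
      -- `r`.
      by_cases hi : σ t i.castSucc = m (t + 1)
      · rw [hi, Equiv.swap_apply_right, H.retract_of_notMem (hm (t + 1))]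
        exact H.eq_root_of_enter (hp t _) (by simpa [hA] using hlast t)
      · rw [Equiv.swap_apply_of_ne_of_ne hne hi]
    · rfl
  refine ⟨fun t i => H.retract (p t (σ t i.castSucc)), fun t i => ?_, ?_⟩
  · simp only [hstep]
    obtain h | h := hp t (σ t i.castSucc)
    · exact .inl (by rw [h])
    · exact H.retract_adj h
  · rintro t x ⟨i, hi⟩
    obtain ⟨j, rfl⟩ := (σ t).surjective i
    obtain ⟨j, rfl⟩ | rfl := j.eq_castSucc_or_eq_last
    · exact ⟨j, by simp only [hi, H.retract_apply]⟩
    · exact absurd ⟨x, hi⟩ (hlast t)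

/-- A rooted part that `k` cops cannot clear is cleared by `k + 1` cops only if they all are there
at some moment. -/
lemma RootedPart.exists_all_inside (H : RootedPart T r G φ) {k : ℕ} (hT : ¬ CopClearable T k)
    {p : ℕ → Fin (k + 1) → V} (hp : IsTokenWalk G p) {f τ : ℕ} (hfτ : f ≤ τ)
    (hf : ∀ x, φ x ∈ dirtyBefore G p f) (hτ : ∀ x, φ x ∉ dirtyAfter G p τ) :
    ∃ a, f ≤ a ∧ a ≤ τ ∧ ∀ i, ∃ x, p a i = φ x := by
  by_contra! hcon
  -- The walk restarts at time `f` and is frozen from `τ` on, so that some cop is outside at every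
  -- time.
  set p' : ℕ → Fin (k + 1) → V := fun t => p (min (f + t) τ) with hp'
  have hwalk : IsTokenWalk G p' := by
    intro t i
    by_cases h : f + t < τ
    · have := hp (f + t) i
      simp only [hp']
      rwa [min_eq_left h.le, min_eq_left (show f + (t + 1) ≤ τ by omega)]
    · refine .inl ?_
      simp only [hp']
      rw [min_eq_right (by omega), min_eq_right (by omega)]
  obtain ⟨q, hq, hocc⟩ := H.exists_shadow hwalk fun t => hcon _ (by omega) (by omega)
  have hocc' : ∀ n, f + n ≤ τ → ∀ x, x ∉ occupied q n → φ x ∉ occupied p (f + n) := by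
    intro n hn x hx h
    refine hx (hocc n x ?_)
    simpa only [occupied, hp', min_eq_left hn] using h
  have key : ∀ n, f + n ≤ τ → ∀ x, x ∈ dirtyBefore T q n → φ x ∈ dirtyBefore G p (f + n) := by
    intro n
    induction n with
    | zero => exact fun _ x _ => hf x
    | succ n ih =>
      rintro hn x ⟨hx, hx'⟩
      have hsub : ∀ y, y ∈ dirtyBefore T q n \ occupied q n →
          φ y ∈ dirtyBefore G p (f + n) \ occupied p (f + n) := fun y hy =>
        ⟨ih (by omega) y hy.1, hocc' n (by omega) y hy.2⟩
      refine ⟨?_, hocc' n (by omega) x hx'⟩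
      by_cases hd : φ x ∈ dirtyBefore G p (f + n) \ occupied p (f + n)
      · exact .inr hd
      · obtain ⟨-, y, hy, hxy⟩ | h := hx
        · exact .inl ⟨hd, φ y, hsub y hy, (H.adj_iff x y).2 hxy⟩
        · exact .inr (hsub x h)
  refine hT ⟨q, hq, τ - f, Set.eq_empty_iff_forall_notMem.2 fun x hx => hτ x ?_⟩
  have hn : f + (τ - f) = τ := by omega
  have h1 := key (τ - f) hn.le x hx.1
  have h2 := hocc' (τ - f) hn.le x hx.2
  rw [hn] at h1 h2
  exact ⟨h1, h2⟩

end Shadow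

/-! ### Distances -/

lemma SimpleGraph.Connected.exists_adj_dist_eq {V : Type*} {G : SimpleGraph V} (hG : G.Connected)
    {x z : V} {n : ℕ} (h : G.dist x z = n + 1) : ∃ y, G.Adj x y ∧ G.dist y z = n := by
  obtain ⟨p, hp⟩ := hG.exists_walk_length_eq_dist x z
  cases p with
  | nil => simp at h
  | @cons _ y _ hxy q =>
    refine ⟨y, hxy, ?_⟩
    have h1 := SimpleGraph.dist_le q
    have h2 := hG.dist_triangle (u := x) (v := y) (w := z)
    have h3 := SimpleGraph.dist_eq_one_iff_adj.2 hxy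
    simp only [SimpleGraph.Walk.length_cons] at hp
    omega

lemma SimpleGraph.Connected.dist_le_dist_add_one {V : Type*} {G : SimpleGraph V}
    (hG : G.Connected) {x y : V} (h : G.Adj x y) (z : V) : G.dist y z ≤ G.dist x z + 1 := by
  have h2 := hG.dist_triangle (u := y) (v := x) (w := z)
  have h3 := SimpleGraph.dist_eq_one_iff_adj.2 h.symm
  omega

lemma SimpleGraph.Connected.lipschitz_le_dist {V : Type*} {G : SimpleGraph V}
    (hG : G.Connected) {h : V → ℕ} (hl : ∀ x y, G.Adj x y → h y ≤ h x + 1) (x y : V) :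
    h x ≤ h y + G.dist x y := by
  induction hn : G.dist x y generalizing x with
  | zero => rw [hG.dist_eq_zero_iff.1 hn]; simp
  | succ n ih =>
    obtain ⟨z, hz, hz'⟩ := hG.exists_adj_dist_eq hn
    have := ih z hz'
    have := hl _ _ hz.symm
    omega

lemma IsTokenWalk.dist_le {V : Type*} {G : SimpleGraph V} (hG : G.Connected) {k : ℕ}
    {p : ℕ → Fin k → V} (hp : IsTokenWalk G p) (z : V) (s n : ℕ) (i : Fin k) :
    G.dist (p s i) z ≤ G.dist (p (s + n) i) z + n := by
  have := (hp.lipschitz (f := fun x => (G.dist x z : ℤ))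
    (fun x y h => by exact_mod_cast hG.dist_le_dist_add_one h z) s n i).2
  exact_mod_cast this

/-! ### Threats -/

section Threat

variable {V : Type*} {G : SimpleGraph V} {k : ℕ} {p : ℕ → Fin k → V}

/-- At time `t` some dirty vertex is closer to `ρ` than every cop, with a margin of `c`. -/
def Threat (G : SimpleGraph V) {k : ℕ} (p : ℕ → Fin k → V) (ρ : V) (c t : ℕ) : Prop :=
  ∃ w ∈ dirtyAfter G p t, ∀ i, G.dist w ρ + c ≤ G.dist (p t i) ρ

/-- Contamination advances along a geodesic to `ρ` by one step per turn; no cop is faster, so none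
catches up. -/
lemma exists_dirty_approaching (hG : G.Connected) (hp : IsTokenWalk G p) {ρ w : V} {c t : ℕ}
    (hc : 1 ≤ c) (hw : w ∈ dirtyAfter G p t) (hcop : ∀ i, G.dist w ρ + c ≤ G.dist (p t i) ρ)
    {n : ℕ} (hn : n ≤ G.dist w ρ) : ∃ y ∈ dirtyAfter G p (t + n), G.dist y ρ + n = G.dist w ρ := by
  induction n with
  | zero => exact ⟨w, hw, rfl⟩
  | succ n ih =>
    obtain ⟨y, hy, hyd⟩ := ih (by omega)
    obtain ⟨z, hz, hzd⟩ := hG.exists_adj_dist_eq (x := y) (z := ρ) (n := G.dist y ρ - 1) (by omega)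
    refine ⟨z, mem_dirtyAfter_succ hy (.inr hz.symm) ?_ ?_, by omega⟩
    · intro i hi
      have := hp.dist_le hG ρ t n i
      rw [show p (t + n) i = z from hi] at this
      have h' := hcop i
      omega
    · intro i hi
      have := hp.dist_le hG ρ t (n + 1) i
      rw [show p (t + (n + 1)) i = z from hi] at this
      have h' := hcop i
      omega

/-- In the whole time span every cop is at distance at least `d + 1` from `ρ`, so contamination
spreads from `ρ` through the ball of radius `d` unhindered. -/
lemma dirty_ball (hG : G.Connected) (hp : IsTokenWalk G p) {ρ w : V} {d t : ℕ}
    (hw : w ∈ dirtyAfter G p t)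
    (hcop : ∀ i, G.dist w ρ + (2 * d + 2) ≤ G.dist (p t i) ρ) {n : ℕ}
    (hn : n ≤ G.dist w ρ + d + 1) {y : V} (hyd : G.dist y ρ ≤ d) (hyn : G.dist w ρ + G.dist y ρ ≤ n) :
    y ∈ dirtyAfter G p (t + n) := by
  induction n generalizing y with
  | zero =>
    have h1 : w = ρ := hG.dist_eq_zero_iff.1 (by omega)
    have h2 : y = ρ := hG.dist_eq_zero_iff.1 (by omega)
    rw [h2, ← h1]; exact hw
  | succ n ih =>
    have hfree : ∀ i, p (t + n) i ≠ y := by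
      intro i hi
      have := hp.dist_le hG ρ t n i
      rw [hi] at this
      have h' := hcop i
      omega
    have hfree' : ∀ i, p (t + n + 1) i ≠ y := by
      intro i hi
      have := hp.dist_le hG ρ t (n + 1) i
      rw [show p (t + (n + 1)) i = y from hi] at this
      have h' := hcop i
      omega
    by_cases h : G.dist w ρ + G.dist y ρ ≤ n
    · exact mem_dirtyAfter_succ (ih (by omega) hyd h) (.inl rfl) hfree hfree'
    · rcases hq : G.dist y ρ with _ | q
      · obtain ⟨z, hz, hzd⟩ := exists_dirty_approaching hG hp (by omega) hw hcop
          (n := n + 1) (by omega)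
        have h1 : z = ρ := hG.dist_eq_zero_iff.1 (by omega)
        have h2 : y = ρ := hG.dist_eq_zero_iff.1 hq
        rwa [h2, ← h1]
      · obtain ⟨z, hz, hzd⟩ := hG.exists_adj_dist_eq hq
        exact mem_dirtyAfter_succ (ih (by omega) (by omega) (y := z) (by omega)) (.inr hz)
          hfree hfree'

end Threat

/-! ### Pendant parts -/

/-- A rooted part `φ` of depth at most `d`, attached to a vertex `v` by a path of length `l`; `h` is
the distance from `v` on the path and the part, and `0` elsewhere. -/
structure IsPendant {U V : Type*} (T : SimpleGraph U) (r : U) (G : SimpleGraph V) (φ : U → V)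
    (v : V) (h : V → ℕ) (l d : ℕ) : Prop where
  part : RootedPart T r G φ
  base : h v = 0
  lip : ∀ x y, G.Adj x y → h y ≤ h x + 1
  down : ∀ x n, h x = n + 1 → ∃ y, G.Adj x y ∧ h y = n
  boundary : ∀ x y, G.Adj x y → h x ≠ 0 → h y = 0 → y = v
  core : ∀ a, l ≤ h (φ a)
  height : ∀ x, h x ≤ l + d
  arm : ∀ x y, h x = h y → 0 < h x → h x < l → x = y
  dist_root : ∀ a, G.dist (φ a) (φ r) ≤ d

namespace IsPendant

variable {U V : Type*} {T : SimpleGraph U} {r : U} {G : SimpleGraph V} {φ : U → V}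
  {v : V} {h : V → ℕ} {l d : ℕ}

lemma dist_base_le (H : IsPendant T r G φ v h l d) (hG : G.Connected) {x : V} (hx : h x ≠ 0) :
    G.dist x v ≤ h x := by
  induction hn : h x generalizing x with
  | zero => exact absurd hn hx
  | succ n ih =>
    obtain ⟨y, hxy, hy⟩ := H.down x n hn
    have h1 := hG.dist_le_dist_add_one hxy.symm v
    by_cases h0 : h y = 0
    · obtain rfl := H.boundary x y hxy hx h0
      rw [SimpleGraph.dist_eq_one_iff_adj.2 hxy]; omega
    · have := ih h0 hy
      omega

lemma le_dist_base (H : IsPendant T r G φ v h l d) (hG : G.Connected) (x : V) :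
    h x ≤ G.dist x v := by
  have := hG.lipschitz_le_dist H.lip x v
  rwa [H.base, zero_add] at this

/-- A path can leave the branch only through `v`. -/
lemma dist_through (H : IsPendant T r G φ v h l d) (hG : G.Connected) {x y : V} (hx : h x ≠ 0)
    (hy : h y = 0) : G.dist x y = G.dist x v + G.dist v y := by
  refine le_antisymm hG.dist_triangle ?_
  induction hn : G.dist x y generalizing x with
  | zero => exact absurd (hG.dist_eq_zero_iff.1 hn ▸ hy) hx
  | succ n ih =>
    obtain ⟨z, hxz, hz⟩ := hG.exists_adj_dist_eq hn
    have h1 := hG.dist_le_dist_add_one hxz.symm v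
    by_cases h0 : h z = 0
    · obtain rfl := H.boundary x z hxz hx h0
      rw [SimpleGraph.dist_eq_one_iff_adj.2 hxz]; omega
    · have := ih h0 hz
      omega

variable {k : ℕ} {p : ℕ → Fin k → V}

/-- A dirty vertex above level `m + 1` reaches that level if no cop is above level `m`. -/
lemma exists_dirty_of_descend (H : IsPendant T r G φ v h l d) {m s n q : ℕ} (hq : q ≤ n) {x : V}
    (hx : x ∈ dirtyAfter G p s) (hxm : h x = m + 1 + q)
    (hfree : ∀ u, s ≤ u → u ≤ s + n → ∀ i, h (p u i) ≤ m) :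
    ∃ z ∈ dirtyAfter G p (s + n), h z = m + 1 := by
  induction n generalizing s q x with
  | zero => exact ⟨x, hx, by omega⟩
  | succ n ih =>
    have step : ∀ y, m < h y → (y = x ∨ G.Adj y x) → y ∈ dirtyAfter G p (s + 1) := fun y hy hyx =>
      mem_dirtyAfter_succ hx hyx
        (by rintro i rfl; have := hfree s le_rfl (by omega) i; omega)
        (by rintro i rfl; have := hfree (s + 1) (by omega) (by omega) i; omega)
    rw [show s + (n + 1) = s + 1 + n by omega]
    rcases q with _ | q
    · exact ih (Nat.zero_le _) (step x (by omega) (.inl rfl)) hxm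
        fun u h1 h2 => hfree u (by omega) (by omega)
    · obtain ⟨y, hxy, hy⟩ := H.down x (m + 1 + q) (by omega)
      exact ih (q := q) (by omega) (step y (by omega) (.inr hxy.symm)) hy
        fun u h1 h2 => hfree u (by omega) (by omega)

/-- The part has a dirty vertex or is threatened. -/
def Unsafe (_ : IsPendant T r G φ v h l d) (p : ℕ → Fin k → V) (t : ℕ) : Prop :=
  (∃ a, φ a ∈ dirtyAfter G p t) ∨ Threat G p (φ r) (2 * d + 2) t

/-- A threat is realized: the whole part becomes dirty, and it is unsafe until then. -/
lemma exists_fill (H : IsPendant T r G φ v h l d) (hG : G.Connected) (hp : IsTokenWalk G p) {t : ℕ}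
    (ht : Threat G p (φ r) (2 * d + 2) t) :
    ∃ N, 1 ≤ N ∧ (∀ n ≤ N, H.Unsafe p (t + n)) ∧ ∀ a, φ a ∈ dirtyAfter G p (t + N) := by
  obtain ⟨w, hw, hcop⟩ := ht
  -- The spread needs only `dist + d` turns; the extra one ensures `1 ≤ N`, so that the filling
  -- comes strictly after the threat.
  refine ⟨G.dist w (φ r) + d + 1, by omega, fun n hn => ?_, fun a => ?_⟩
  · by_cases hn' : n ≤ G.dist w (φ r)
    · obtain ⟨y, hy, hyd⟩ := exists_dirty_approaching hG hp (by omega) hw hcop hn'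
      refine .inr ⟨y, hy, fun i => ?_⟩
      have := hp.dist_le hG (φ r) t n i
      have := hcop i
      omega
    · exact .inl ⟨r, dirty_ball hG hp hw hcop hn (by simp) (by simp; omega)⟩
  · have := H.dist_root a
    exact dirty_ball hG hp hw hcop le_rfl this (by omega)

/-- The last threat before `τ` has been realized by time `τ`, as the part is safe then. From the
moment it was entirely dirty (time `0` if there was no threat), cleaning it took a visit of all
cops. -/
lemma exists_last_visit {p : ℕ → Fin (k + 1) → V} (H : IsPendant T r G φ v h l d)
    (hG : G.Connected) (hp : IsTokenWalk G p)
    (hT : ¬ CopClearable T k) {τ : ℕ} (hτ : ¬ H.Unsafe p τ) :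
    ∃ a ≤ τ, (∀ i, ∃ x, p a i = φ x) ∧
      ∀ s, a ≤ s → s ≤ τ → ¬ Threat G p (φ r) (2 * d + 2) s := by
  classical
  have hclean : ∀ x, φ x ∉ dirtyAfter G p τ := fun x hx => hτ (.inl ⟨x, hx⟩)
  by_cases hex : ∃ s ≤ τ, Threat G p (φ r) (2 * d + 2) s
  · obtain ⟨s₀, hs₀, hth₀⟩ := hex
    set σ := Nat.findGreatest (Threat G p (φ r) (2 * d + 2)) τ with hσ
    have hth : Threat G p (φ r) (2 * d + 2) σ := Nat.findGreatest_spec hs₀ hth₀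
    have hστ : σ ≤ τ := Nat.findGreatest_le τ
    obtain ⟨N, hN, hun, hfill⟩ := H.exists_fill hG hp hth
    have hle : σ + N ≤ τ := by
      by_contra hlt
      apply hτ
      have := hun (τ - σ) (by omega)
      rwa [show σ + (τ - σ) = τ by omega] at this
    obtain ⟨a, h1, h2, h3⟩ := H.part.exists_all_inside hT hp hle (fun x => (hfill x).1) hclean
    exact ⟨a, h2, h3, fun s h4 h5 => Nat.findGreatest_is_greatest (by omega) h5⟩
  · push Not at hex
    obtain ⟨a, h1, h2, h3⟩ :=
      H.part.exists_all_inside hT hp (Nat.zero_le τ) (fun x => trivial) hclean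
    exact ⟨a, h2, h3, fun s _ h5 => hex s h5⟩

end IsPendant

/-! ### All cops inside one pendant part -/

namespace IsPendant

variable {U V : Type*} {T : SimpleGraph U} {r : U} {G : SimpleGraph V} {φ φ' ψ : U → V}
  {v u : V} {h h' g : V → ℕ} {l d : ℕ} {k : ℕ} {p : ℕ → Fin k → V}

lemma exists_level (H : IsPendant T r G φ v h l d) {m : ℕ} {x : V} (hx : m ≤ h x) :
    ∃ z, h z = m := by
  induction hn : h x - m generalizing x with
  | zero => exact ⟨x, by omega⟩
  | succ n ih =>
    obtain ⟨y, -, hy⟩ := H.down x (h x - 1) (by omega)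
    exact ih (x := y) (by omega) (by omega)

/-- If all cops are in one of two pendant parts at the same vertex and the other branch has a dirty
vertex, then it has one close to that vertex. -/
lemma exists_dirty_low (H : IsPendant T r G φ v h l d) (H' : IsPendant T r G φ' v h' l d)
    (hdis : ∀ x, h x ≠ 0 → h' x = 0) (hp : IsTokenWalk G p) {t m : ℕ} (hm : d ≤ 2 * m + 1)
    (hml : m + 1 < l) (hin : ∀ i, ∃ x, p t i = φ x) {w : V} (hw : w ∈ dirtyAfter G p t)
    (hw0 : h' w ≠ 0) : ∃ z ∈ dirtyAfter G p t, h' z ≠ 0 ∧ h' z ≤ m + 1 := by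
  classical
  by_cases hwm : h' w ≤ m + 1
  · exact ⟨w, hw, hw0, hwm⟩
  suffices hz : ∃ z ∈ dirtyAfter G p t, h' z = m + 1 by
    obtain ⟨z, hz, hzm⟩ := hz
    exact ⟨z, hz, by omega, by omega⟩
  have hcore : ∀ i, l ≤ h (p t i) ∧ h' (p t i) = 0 := by
    intro i
    obtain ⟨x, hx⟩ := hin i
    have := H.core x
    rw [hx]
    exact ⟨this, hdis _ (by omega)⟩
  -- Consider the earliest time from which, until `t`, no cop is above level `m` of the dirty
  -- branch.
  have hex : ∃ s, s ≤ t ∧ ∀ u, s ≤ u → u ≤ t → ∀ i, h' (p u i) ≤ m :=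
    ⟨t, le_rfl, fun u h1 h2 i => by
      obtain rfl : u = t := by omega
      rw [(hcore i).2]; omega⟩
  obtain ⟨hst, hfree⟩ := Nat.find_spec hex
  have hmin := fun s => Nat.find_min hex (m := s)
  set s₀ := Nat.find hex
  rcases hs : s₀ with _ | s
  · rw [hs] at hfree
    obtain ⟨z, hz⟩ := H'.exists_level (m := m + 1) (x := w) (by omega)
    have hne : ∀ u, 0 ≤ u → u ≤ t → ∀ i, p u i ≠ z := by
      rintro u h1 h2 i rfl
      have := hfree u h1 h2 i
      omega
    exact ⟨z, mem_dirtyAfter_of_le (mem_dirtyAfter_zero (hne 0 le_rfl (Nat.zero_le _)))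
      (Nat.zero_le _) hne, hz⟩
  · rw [hs] at hfree hst
    obtain ⟨i, hi⟩ : ∃ i, m < h' (p s i) := by
      by_contra! hcon
      refine hmin s (by omega) ⟨by omega, fun u h1 h2 => ?_⟩
      obtain rfl | h1 := h1.eq_or_lt
      · exact hcon
      · exact hfree u h1 h2
    -- This cop has since walked down to `v`, at least `m + 1` steps, and then at least `l` steps
    -- into the other part; `h - h'` measures this.
    have hlong : l + m + 1 ≤ t - s := by
      have := (hp.lipschitz (f := fun x => (h x : ℤ) - h' x) ?_ s (t - s) i).1
      · rw [show s + (t - s) = t by omega] at this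
        have h1 := hcore i
        have h2 : h (p s i) = 0 := by
          by_contra h0
          have := hdis _ h0
          omega
        simp only [h1.2, h2] at this
        omega
      · intro x y hxy
        have h1 := H.lip x y hxy
        have h2 := H'.lip y x hxy.symm
        have h3 := hdis x
        have h4 := hdis y
        by_cases hy : h y = 0
        · push_cast [hy]; omega
        · by_cases hx : h x = 0
          · obtain rfl := H.boundary y x hxy.symm hy hx
            have := H'.base
            have := h4 hy
            omega
          · have := h3 hx
            have := h4 hy
            omega
    -- A dirty vertex on level `m + 1` stays dirty, being unvisited. As long as there is none,
    -- contamination above this level cannot come from below and hence dates back to time `s + 1`.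
    have inv : ∀ n, s + 1 + n ≤ t → (∃ z ∈ dirtyAfter G p (s + 1 + n), h' z = m + 1) ∨
        ∀ x ∈ dirtyAfter G p (s + 1 + n), m + 1 < h' x →
          ∃ y ∈ dirtyAfter G p (s + 1), m + 1 < h' y := by
      intro n
      induction n with
      | zero => exact fun _ => .inr fun x hx hxm => ⟨x, hx, hxm⟩
      | succ n ih =>
        intro hn
        rw [or_iff_not_imp_left]
        intro hno x hx hxm
        obtain ⟨y, hy, hxy⟩ := exists_of_mem_dirtyAfter_succ hx
        have hno' : ¬ ∃ z ∈ dirtyAfter G p (s + 1 + n), h' z = m + 1 := by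
          rintro ⟨z, hz, hzm⟩
          refine hno ⟨z, mem_dirtyAfter_succ hz (.inl rfl) ?_ ?_, hzm⟩
          · intro i hi
            have := hfree (s + 1 + n) (by omega) (by omega) i
            rw [show p (s + 1 + n) i = z from hi] at this
            omega
          · intro i hi
            have := hfree (s + 1 + n + 1) (by omega) (by omega) i
            rw [show p (s + 1 + n + 1) i = z from hi] at this
            omega
        refine (ih (by omega)).resolve_left hno' y hy ?_
        obtain rfl | hxy := hxy
        · exact hxm
        · have h1 := H'.lip y x hxy.symm
          have h2 : h' y ≠ m + 1 := fun h2 => hno' ⟨y, hy, h2⟩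
          omega
    have hfin := inv (t - (s + 1)) (by omega)
    rw [show s + 1 + (t - (s + 1)) = t by omega] at hfin
    obtain hz | hy := hfin
    · exact hz
    · obtain ⟨y, hy, hym⟩ := hy w hw (by omega)
      have hle := H'.height y
      -- At least `l + m` turns remain for a descent of at most `l + d - (m + 1)` levels, which is
      -- enough since `d ≤ 2 * m + 1`.
      have := H'.exists_dirty_of_descend (m := m) (n := t - (s + 1)) (q := h' y - (m + 1))
        (by omega) hy (by omega) fun u h1 h2 => hfree u h1 (by omega)
      rwa [show s + 1 + (t - (s + 1)) = t by omega] at this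

/-- If all cops are in a pendant part and its sibling is unsafe, then every part elsewhere is
threatened. -/
lemma threat_of_unsafe_sibling (H : IsPendant T r G φ v h l d) (H' : IsPendant T r G φ' v h' l d)
    (hG : G.Connected) (hdis : ∀ x, h x ≠ 0 → h' x = 0) (hp : IsTokenWalk G p)
    (hnum : 5 * d + 8 ≤ 2 * l) {ρ : V} (hρ : h ρ = 0) (hρ' : h' ρ = 0) {t : ℕ}
    (hin : ∀ i, ∃ x, p t i = φ x) (hun : H'.Unsafe p t) : Threat G p ρ (2 * d + 2) t := by
  have hcore : ∀ i, l ≤ h (p t i) := by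
    intro i
    obtain ⟨x, hx⟩ := hin i
    rw [hx]; exact H.core x
  have hcop : ∀ i, l ≤ G.dist (p t i) v ∧
      G.dist (p t i) ρ = G.dist (p t i) v + G.dist v ρ := fun i =>
    ⟨(hcore i).trans (H.le_dist_base hG _),
      H.dist_through hG (by have := hcore i; omega) hρ⟩
  have hlow : ∀ w ∈ dirtyAfter G p t, h' w ≠ 0 → Threat G p ρ (2 * d + 2) t := by
    intro w hw hw0
    -- `d / 2` is the least admissible `m`. Then `z` is within `d / 2 + 1` of `v` and the cops are
    -- at least `l` away from it; `hnum` turns this into the margin `2 * d + 2`.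
    obtain ⟨z, hz, hz0, hzm⟩ := exists_dirty_low H H' hdis hp (m := d / 2) (by omega) (by omega)
      hin hw hw0
    refine ⟨z, hz, fun i => ?_⟩
    have h1 := H'.dist_through hG hz0 hρ'
    have h2 := H'.dist_base_le hG hz0
    have h3 := hcop i
    omega
  obtain ⟨a, ha⟩ | ⟨w, hw, hwc⟩ := hun
  · exact hlow _ ha (by have := H'.core a; omega)
  · by_cases hw0 : h' w = 0
    -- Both `w` and the cops are separated from `φ' r` by `v`, so the margin already holds for
    -- distances to `v`. It carries over to `ρ`, which the cops too reach only through `v`.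
    · refine ⟨w, hw, fun i => ?_⟩
      have hr : h' (φ' r) ≠ 0 := by have := H'.core r; omega
      have h1 := hcop i
      have h2 := hwc i
      have h3 := H'.dist_through hG hr hw0
      have h4 := H'.dist_through hG hr (hdis (p t i) (by have := hcore i; omega))
      have h5 := hG.dist_triangle (u := w) (v := v) (w := ρ)
      rw [SimpleGraph.dist_comm] at h3 h4
      rw [G.dist_comm (u := v)] at h3 h4
      omega
    · exact hlow w hw hw0

/-- If all cops are in another pendant part, then a dirty part is threatened. -/
lemma threat_of_dirty (H : IsPendant T r G φ v h l d) (K : IsPendant T r G ψ u g l d)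
    (hG : G.Connected) (hnum : 5 * d + 8 ≤ 2 * l) (hv : g v = 0) (hρ : h (ψ r) = 0)
    {t : ℕ} (hin : ∀ i, ∃ x, p t i = φ x) {a : U} (ha : ψ a ∈ dirtyAfter G p t) :
    Threat G p (ψ r) (2 * d + 2) t := by
  -- The dirty vertex is within `d` of `ψ r`, while every cop is at least `2 * l` away: one arm out
  -- and one arm in.
  refine ⟨_, ha, fun i => ?_⟩
  obtain ⟨x, hx⟩ := hin i
  have hc := H.core x
  rw [hx]
  have h1 := H.dist_through hG (x := φ x) (by omega) hρ
  have h2 := H.le_dist_base hG (φ x)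
  have h3 := hG.lipschitz_le_dist K.lip (ψ r) v
  have h4 := K.core r
  have h5 := K.dist_root a
  rw [G.dist_comm] at h3
  omega

/-- A part stays unsafe while no cop is in it. -/
lemma Unsafe.succ {K : IsPendant T r G ψ u g l d} (hG : G.Connected) (hp : IsTokenWalk G p) {t : ℕ}
    (hun : K.Unsafe p t) (h1 : ∀ i a, p t i ≠ ψ a) (h2 : ∀ i a, p (t + 1) i ≠ ψ a) :
    K.Unsafe p (t + 1) := by
  obtain ⟨a, ha⟩ | hth := hun
  · exact .inl ⟨a, mem_dirtyAfter_succ ha (.inl rfl) (fun i => h1 i a) fun i => h2 i a⟩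
  · obtain ⟨N, hN, h, -⟩ := K.exists_fill hG hp hth
    exact h 1 hN

end IsPendant

/-! ### Four pendant parts cost one more cop -/

section FourParts

variable {U V : Type*} {T : SimpleGraph U} {r : U} {G : SimpleGraph V} {φ : Bool → Bool → U → V}
  {v : Bool → V} {h : Bool → Bool → V → ℕ} {l d : ℕ}

/-- Since the part `(b, c)` is not threatened at time `a`, neither it nor the sibling of the visited
part can be unsafe then. No cop was in these two parts at time `a - 1` either, so both were safe
already, against `hmin`. If `a = 0`, the first of them is still dirty. -/
lemma not_visit_while_safe (H : ∀ b c, IsPendant T r G (φ b c) (v b) (h b c) l d)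
    (hG : G.Connected)
    (hdis : ∀ b c b' c' x, (b, c) ≠ (b', c') → h b c x ≠ 0 → h b' c' x = 0)
    (hv : ∀ b b' c, h b' c (v b) = 0) (hnum : 5 * d + 8 ≤ 2 * l) {k : ℕ} {p : ℕ → Fin k → V}
    (hp : IsTokenWalk G p) {b c c' : Bool} {a : ℕ}
    (hmin : ∀ t < a, ∀ c c', (H b c).Unsafe p t ∨ (H (!b) c').Unsafe p t)
    (hin : ∀ i, ∃ x, p a i = φ (!b) c' x)
    (hth : ¬ Threat G p (φ b c r) (2 * d + 2) a) : False := by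
  have hne : ∀ c', (!b, c') ≠ (b, c) := by simp
  have hne' : ((!b, c') : Bool × Bool) ≠ (!b, !c') := by simp
  have hρ : ∀ c', h (!b) c' (φ b c r) = 0 := fun c' =>
    hdis _ _ _ _ _ (hne c').symm (by have := (H b c).core r; omega)
  have hXun : ¬ (H b c).Unsafe p a := by
    rintro (⟨x, hx⟩ | h)
    · exact hth ((H (!b) c').threat_of_dirty (H b c) hG hnum (hv _ _ _) (hρ _) hin hx)
    · exact hth h
  have hYun : ¬ (H (!b) (!c')).Unsafe p a := fun hun =>
    hth ((H (!b) c').threat_of_unsafe_sibling (H (!b) (!c')) hG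
      (fun x => hdis _ _ _ _ x hne') hp hnum (hρ _) (hρ _) hin hun)
  have hcore : ∀ i, l ≤ h (!b) c' (p a i) := by
    intro i
    obtain ⟨x, hx⟩ := hin i
    rw [hx]; exact (H _ _).core x
  have havoid : ∀ b₁ c₁ x, (!b, c') ≠ (b₁, c₁) → h (!b) c' x ≠ 0 → ∀ y, x ≠ φ b₁ c₁ y := by
    rintro b₁ c₁ x hbc hx y rfl
    have h1 := hdis _ _ _ _ _ hbc hx
    have h2 := (H b₁ c₁).core y
    omega
  rcases a with _ | t
  · exact hXun (.inl ⟨r, mem_dirtyAfter_zero fun i =>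
      havoid b c _ (hne c') (by have := hcore i; omega) r⟩)
  · have hcore' : ∀ i, h (!b) c' (p t i) ≠ 0 := by
      intro i
      have h1 := hcore i
      obtain h2 | h2 := hp t i
      · rw [← h2]; omega
      · have := (H (!b) c').lip _ _ h2
        omega
    have hsucc : ∀ b₁ c₁, (!b, c') ≠ (b₁, c₁) → (H b₁ c₁).Unsafe p t →
        (H b₁ c₁).Unsafe p (t + 1) := fun b₁ c₁ hbc hun =>
      hun.succ hG hp (fun i => havoid _ _ _ hbc (hcore' i))
        fun i => havoid _ _ _ hbc (by have := hcore i; omega)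
    obtain hun | hun := hmin t (by omega) c (!c')
    · exact hXun (hsucc _ _ (hne c') hun)
    · exact hYun (hsucc _ _ hne' hun)

/-- If `G` contains four pendant copies of `T`, two at each of two vertices, then clearing `G` takes
more cops than clearing `T`. -/
theorem not_copClearable_of_four_parts (H : ∀ b c, IsPendant T r G (φ b c) (v b) (h b c) l d)
    (hG : G.Connected)
    (hdis : ∀ b c b' c' x, (b, c) ≠ (b', c') → h b c x ≠ 0 → h b' c' x = 0)
    (hv : ∀ b b' c, h b' c (v b) = 0) (hnum : 5 * d + 8 ≤ 2 * l) {k : ℕ}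
    (hT : ¬ CopClearable T k) : ¬ CopClearable G (k + 1) := by
  classical
  rintro ⟨p, hp, e, he⟩
  have hex : ∃ τ, ∃ c c', ¬ (H false c).Unsafe p τ ∧ ¬ (H true c').Unsafe p τ := by
    have hsafe : ∀ b c, ¬ (H b c).Unsafe p e := by
      rintro b c (⟨a, ha⟩ | ⟨w, hw, -⟩)
      · exact (he ▸ ha : φ b c a ∈ (∅ : Set V))
      · exact (he ▸ hw : w ∈ (∅ : Set V))
    exact ⟨e, false, false, hsafe _ _, hsafe _ _⟩
  obtain ⟨c, c', h1, h2⟩ := Nat.find_spec hex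
  have hmin := fun t => Nat.find_min hex (m := t)
  set τ := Nat.find hex
  push Not at hmin
  obtain ⟨a₁, ha₁, hin₁, hth₁⟩ := (H false c).exists_last_visit hG hp hT h1
  obtain ⟨a₂, ha₂, hin₂, hth₂⟩ := (H true c').exists_last_visit hG hp hT h2
  -- The later of the two visits is the impossible one: the part visited earlier is not threatened
  -- at that time.
  rcases le_total a₁ a₂ with h | h
  · exact not_visit_while_safe H hG hdis hv hnum hp (b := false) (c := c)
      (fun t ht c c' => or_iff_not_imp_left.2 (hmin t (by omega) c c')) hin₂ (hth₁ a₂ h ha₂)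
  · exact not_visit_while_safe H hG hdis hv hnum hp (b := true) (c := c')
      (fun t ht c c' => (or_iff_not_imp_left.2 (hmin t (by omega) c' c)).symm) hin₁ (hth₂ a₁ h ha₁)

end FourParts

/-! ### Two lions that may jump -/

/-- A step of two lions: both stay or move along edges, or one stays and the other one jumps. -/
def JumpStep {V : Type*} (G : SimpleGraph V) (c c' : V × V) : Prop :=
  ((c'.1 = c.1 ∨ G.Adj c.1 c'.1) ∧ (c'.2 = c.2 ∨ G.Adj c.2 c'.2)) ∨ c'.1 = c.1 ∨ c'.2 = c.2

/-- An evader can go from `e` to `e'` while the lions go from `c` to `c'`. -/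
structure Evades {V : Type*} (G : SimpleGraph V) (c c' : V × V) (e e' : V) : Prop where
  move : e' = e ∨ G.Adj e e'
  before_fst : e ≠ c.1
  before_snd : e ≠ c.2
  after_fst : e' ≠ c'.1
  after_snd : e' ≠ c'.2
  cross_fst : ¬ (e = c'.1 ∧ e' = c.1)
  cross_snd : ¬ (e = c'.2 ∧ e' = c.2)

/-- The lions can go from `c` to `c'` in `n` steps such that every evader that is not caught goes
from some `e` to some `e'` with `R e e'`. -/
inductive Sweep {V : Type*} (G : SimpleGraph V) : ℕ → V × V → V × V → (V → V → Prop) → Prop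
  | refl (c : V × V) {R : V → V → Prop} (h : ∀ e, R e e) : Sweep G 0 c c R
  | step {n : ℕ} {c c' c'' : V × V} {R R' : V → V → Prop} (hs : Sweep G n c c' R)
      (hj : JumpStep G c' c'') (h : ∀ e e' e'', R e e' → Evades G c' c'' e' e'' → R' e e'') :
      Sweep G (n + 1) c c'' R'

section Sweep

variable {V : Type*} {G : SimpleGraph V}

lemma JumpStep.symm {c c' : V × V} (h : JumpStep G c c') : JumpStep G c' c := by
  obtain ⟨h1, h2⟩ | h | h := h
  · exact .inl ⟨h1.imp Eq.symm SimpleGraph.Adj.symm, h2.imp Eq.symm SimpleGraph.Adj.symm⟩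
  · exact .inr (.inl h.symm)
  · exact .inr (.inr h.symm)

lemma Evades.symm {c c' : V × V} {e e' : V} (h : Evades G c c' e e') : Evades G c' c e' e where
  move := h.move.imp Eq.symm SimpleGraph.Adj.symm
  before_fst := h.after_fst
  before_snd := h.after_snd
  after_fst := h.before_fst
  after_snd := h.before_snd
  cross_fst := fun ⟨h1, h2⟩ => h.cross_fst ⟨h2, h1⟩
  cross_snd := fun ⟨h1, h2⟩ => h.cross_snd ⟨h2, h1⟩

namespace Sweep

lemma mono {n : ℕ} {c c' : V × V} {R R' : V → V → Prop} (hs : Sweep G n c c' R)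
    (h : ∀ e e', R e e' → R' e e') : Sweep G n c c' R' := by
  cases hs with
  | refl c h0 => exact .refl c fun e => h _ _ (h0 e)
  | step hs hj h0 => exact .step hs hj fun e e' e'' h1 h2 => h _ _ (h0 e e' e'' h1 h2)

lemma single {c c' : V × V} (hj : JumpStep G c c') : Sweep G 1 c c' (Evades G c c') :=
  .step (.refl c (R := fun e e' => e = e') fun _ => rfl) hj (by rintro e _ e'' rfl h; exact h)

lemma trans {m n : ℕ} {c c' c'' : V × V} {R R' : V → V → Prop} (h1 : Sweep G m c c' R)
    (h2 : Sweep G n c' c'' R') :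
    Sweep G (m + n) c c'' (fun e e'' => ∃ e', R e e' ∧ R' e' e'') := by
  induction h2 with
  | refl c h => exact h1.mono fun e e' he => ⟨e', he, h e'⟩
  | step hs hj h ih =>
    exact .step (ih h1) hj fun e e' e'' ⟨x, hx, hx'⟩ he => ⟨x, hx, h _ _ _ hx' he⟩

/-- Reversing all moves turns uncaught trajectories into uncaught trajectories, because both
`JumpStep` and `Evades` are symmetric. -/
lemma symm {n : ℕ} {c c' : V × V} {R : V → V → Prop} (hs : Sweep G n c c' R) :
    Sweep G n c' c (fun e e' => R e' e) := by
  induction hs with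
  | refl c h => exact .refl c h
  | @step n c c' c'' R R' hs hj h ih =>
    have := (single hj.symm).trans ih
    rw [add_comm] at this
    exact this.mono fun e e' ⟨x, hx, hx'⟩ => h _ _ _ hx' hx.symm

lemma lipschitz {n : ℕ} {c c' : V × V} {R : V → V → Prop} (hs : Sweep G n c c' R) {f : V → ℕ}
    (hf : ∀ x y, G.Adj x y → f y ≤ f x + 1) :
    Sweep G n c c' (fun e e' => R e e' ∧ f e' ≤ f e + n) := by
  induction hs with
  | refl c h => exact .refl c fun e => ⟨h e, le_rfl⟩
  | step hs hj h ih =>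
    refine .step ih hj fun e e' e'' ⟨h1, h2⟩ he => ⟨h _ _ _ h1 he, ?_⟩
    obtain h3 | h3 := he.move
    · rw [h3]; omega
    · have := hf _ _ h3; omega

lemma uncaught {n : ℕ} {c c' : V × V} {R : V → V → Prop} (hs : Sweep G n c c' R) (hn : n ≠ 0) :
    Sweep G n c c' (fun e e' => R e e' ∧ e' ≠ c'.1 ∧ e' ≠ c'.2) := by
  cases hs with
  | refl c h => exact absurd rfl hn
  | step hs hj h =>
    exact .step hs hj fun e e' e'' h1 he => ⟨h _ _ _ h1 he, he.after_fst, he.after_snd⟩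

/-- One lion walks along a path `a 0, …, a (m + 1)` and pushes the evaders on it towards `K`, while
the other one stays at `x`. -/
lemma push {a : ℕ → V} {m : ℕ} {x : V} {K : Set V}
    (ha : ∀ j, j ≤ m → G.Adj (a j) (a (j + 1)))
    (hnb : ∀ j, j < m → ∀ w, G.Adj (a (j + 1)) w → w = a j ∨ w = a (j + 2))
    (hend : a (m + 1) ∈ K ∨ a (m + 1) = x)
    (hK : ∀ e ∈ K, ∀ w, G.Adj e w → w ∈ K ∨ w = x ∨ (e = a (m + 1) ∧ w = a m)) :
    Sweep G (m + 1) (x, a 0) (x, a (m + 1)) (fun e e' =>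
      ((∃ j, 0 < j ∧ j ≤ m ∧ e = a j) ∨ e ∈ K) → e' ∈ K) := by
  -- The evaders stay ahead of the lion on the path or in `K`: the only way past it is to swap
  -- places with it along an edge, which is forbidden.
  have key : ∀ i, i ≤ m + 1 → Sweep G i (x, a 0) (x, a i) (fun e e' =>
      ((∃ j, 0 < j ∧ j ≤ m ∧ e = a j) ∨ e ∈ K) →
        (∃ j, i < j ∧ j ≤ m ∧ e' = a j) ∨ e' ∈ K) := by
    intro i
    induction i with
    | zero => exact fun _ => .refl _ fun e h => h
    | succ i ih =>
      intro hi
      refine .step (ih (by omega)) (.inr (.inl rfl)) fun e e' e'' h he h0 => ?_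
      have hx : e'' ≠ x := he.after_fst
      have hai : e'' ≠ a (i + 1) := he.after_snd
      have hcross : ¬ (e' = a (i + 1) ∧ e'' = a i) := he.cross_snd
      have stay : ∀ j, i < j → j ≤ m → e'' = a j →
          (∃ j, i + 1 < j ∧ j ≤ m ∧ e'' = a j) ∨ e'' ∈ K := by
        rintro j h1 h2 rfl
        obtain rfl | h1 := Nat.lt_iff_add_one_le.1 h1 |>.eq_or_lt
        · exact absurd rfl hai
        · exact .inl ⟨j, h1, h2, rfl⟩
      obtain ⟨j, hj1, hj2, rfl⟩ | hK' := h h0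
      · obtain rfl | hadj := he.move
        · exact stay j hj1 hj2 rfl
        · obtain ⟨j, rfl⟩ : ∃ j', j = j' + 1 := ⟨j - 1, by omega⟩
          obtain h1 | h1 := hnb j (by omega) _ hadj
          · obtain rfl | hj1 := (show i ≤ j by omega).eq_or_lt
            · exact absurd ⟨rfl, h1⟩ hcross
            · exact stay j hj1 (by omega) h1
          · obtain rfl | hj3 := hj2.eq_or_lt
            · obtain h2 | h2 := hend
              · exact .inr (by rw [h1]; exact h2)
              · exact absurd (h1.trans h2) hx
            · exact stay (j + 2) (by omega) (by omega) h1
      · obtain rfl | hadj := he.move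
        · exact .inr hK'
        · obtain h1 | h1 | ⟨h1, h2⟩ := hK e' hK' e'' hadj
          · exact .inr h1
          · exact absurd h1 hx
          · obtain rfl | hi := (show i ≤ m by omega).eq_or_lt
            · exact absurd ⟨h1, h2⟩ hcross
            · exact stay m hi le_rfl h2
  refine (key (m + 1) le_rfl).mono fun e e' h h0 => ?_
  obtain ⟨j, h1, h2, -⟩ | h := h h0
  · omega
  · exact h

end Sweep

end Sweep

/-! ### Depth along one branch of a join -/

/-- The distance from the root on branch `b` of a join, and `0` elsewhere. -/
def branchDepth {V : Type} (h : V → ℕ) (m : ℕ) (b : Bool) : JoinVertex V m → ℕ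
  | .root => 0
  | .path b' j => if b' = b then j + 1 else 0
  | .copy b' x => if b' = b then m + 1 + h x else 0

section BranchDepth

variable {V : Type} {G : SimpleGraph V} {r : V} {h : V → ℕ} {m : ℕ} {b : Bool}

lemma branchDepth_armVertex (hr : h r = 0) (b' : Bool) {j : ℕ} (hj : j ≤ m + 1) :
    branchDepth h m b (armVertex r m b' j) = if b' = b then j else 0 := by
  unfold armVertex
  split_ifs with h0 h1 h2 <;> simp_all [branchDepth] <;> omega

lemma branchDepth_le_of_adj (H : IsDepth G r h) {x y : JoinVertex V m}
    (hxy : (joinGraph G r m).Adj x y) : branchDepth h m b y ≤ branchDepth h m b x + 1 := by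
  rcases x with _ | ⟨b', j⟩ | ⟨b', x⟩
  · obtain ⟨b', rfl⟩ := joinGraph_adj_root.1 hxy
    rw [branchDepth_armVertex H.root _ (by omega)]
    split_ifs <;> omega
  · have := j.2
    obtain rfl | rfl := joinGraph_adj_path.1 hxy <;>
      rw [branchDepth_armVertex H.root _ (by omega)] <;> simp only [branchDepth] <;>
      split_ifs <;> omega
  · obtain ⟨z, hz, rfl⟩ | ⟨rfl, rfl⟩ := joinGraph_adj_copy.1 hxy
    · have := H.adj _ _ hz
      simp only [branchDepth]
      split_ifs <;> omega
    · rw [branchDepth_armVertex H.root _ (by omega)]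
      simp only [branchDepth]
      split_ifs <;> omega

lemma exists_branchDepth_eq (H : IsDepth G r h) {x : JoinVertex V m} {n : ℕ}
    (hx : branchDepth h m b x = n + 1) :
    ∃ y, (joinGraph G r m).Adj x y ∧ branchDepth h m b y = n := by
  rcases x with _ | ⟨b', j⟩ | ⟨b', x⟩
  · simp [branchDepth] at hx
  · have := j.2
    refine ⟨_, joinGraph_adj_path.2 (.inl rfl), ?_⟩
    rw [branchDepth_armVertex H.root _ (by omega)]
    simp only [branchDepth] at hx
    split_ifs at hx ⊢
    omega
  · simp only [branchDepth] at hx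
    split_ifs at hx with hb
    subst hb
    by_cases hxr : x = r
    · refine ⟨_, joinGraph_adj_copy.2 (.inr ⟨hxr, rfl⟩), ?_⟩
      rw [branchDepth_armVertex H.root _ (by omega), if_pos rfl]
      rw [hxr, H.root] at hx
      omega
    · obtain ⟨y, h1, h2⟩ := H.parent x hxr
      refine ⟨_, joinGraph_adj_copy.2 (.inl ⟨y, h1, rfl⟩), ?_⟩
      simp only [branchDepth, if_pos]
      omega

lemma eq_root_of_branchDepth_eq_zero (H : IsDepth G r h) {x y : JoinVertex V m}
    (hxy : (joinGraph G r m).Adj x y) (hx : branchDepth h m b x ≠ 0)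
    (hy : branchDepth h m b y = 0) : y = .root := by
  have key : ∀ b' j, j ≤ m + 1 → b' = b → branchDepth h m b (armVertex r m b' j) = 0 →
      armVertex r m b' j = .root := by
    intro b' j hj hb h0
    rw [branchDepth_armVertex H.root _ hj, if_pos hb] at h0
    exact armVertex_eq_root_iff.2 h0
  rcases x with _ | ⟨b', j⟩ | ⟨b', x⟩
  · simp [branchDepth] at hx
  · have := j.2
    have hb : b' = b := by by_contra hb; simp [branchDepth, hb] at hx
    obtain rfl | rfl := joinGraph_adj_path.1 hxy
    · exact key b' _ (by omega) hb hy
    · exact key b' _ (by omega) hb hy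
  · have hb : b' = b := by by_contra hb; simp [branchDepth, hb] at hx
    obtain ⟨z, hz, rfl⟩ | ⟨rfl, rfl⟩ := joinGraph_adj_copy.1 hxy
    · simp [branchDepth, hb] at hy
    · exact key b' _ (by omega) hb hy

lemma exists_path_of_branchDepth_lt {x : JoinVertex V m} (h0 : 0 < branchDepth h m b x)
    (hm : branchDepth h m b x < m + 1) :
    ∃ j : Fin m, x = .path b j ∧ branchDepth h m b x = j + 1 := by
  rcases x with _ | ⟨b', j⟩ | ⟨b', x⟩ <;> simp only [branchDepth] at h0 hm
  · omega
  · split_ifs at h0 with hb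
    · exact ⟨j, by rw [hb], by simp [branchDepth, hb]⟩
    · omega
  · split_ifs at h0 hm <;> omega

lemma eq_of_branchDepth_eq {x y : JoinVertex V m} (hxy : branchDepth h m b x = branchDepth h m b y)
    (h0 : 0 < branchDepth h m b x) (hm : branchDepth h m b x < m + 1) : x = y := by
  obtain ⟨i, rfl, hi⟩ := exists_path_of_branchDepth_lt h0 hm
  obtain ⟨j, rfl, hj⟩ := exists_path_of_branchDepth_lt (hxy ▸ h0) (hxy ▸ hm)
  obtain rfl : i = j := Fin.ext (by omega)
  rfl

end BranchDepth

/-- The distance from the root of copy `b` on its branch `c`, and `0` elsewhere. -/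
def nestedDepth {V : Type} (h : V → ℕ) (m n : ℕ) (b c : Bool) : JoinVertex (JoinVertex V m) n → ℕ
  | .copy b' y => if b' = b then branchDepth h m c y else 0
  | _ => 0

lemma nestedDepth_armVertex {V : Type} (h : V → ℕ) (m n : ℕ) (b c b' : Bool) (j : ℕ) :
    nestedDepth h m n b c (armVertex .root n b' j) = 0 := by
  unfold armVertex
  split_ifs <;> simp [nestedDepth, branchDepth]

lemma exists_of_nestedDepth_ne_zero {V : Type} {h : V → ℕ} {m n : ℕ} {b c : Bool}
    {x : JoinVertex (JoinVertex V m) n} (hx : nestedDepth h m n b c x ≠ 0) :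
    ∃ y, x = .copy b y ∧ nestedDepth h m n b c x = branchDepth h m c y := by
  rcases x with _ | ⟨b', j⟩ | ⟨b', y⟩
  · simp [nestedDepth] at hx
  · simp [nestedDepth] at hx
  · by_cases hb : b' = b
    · subst hb; exact ⟨y, rfl, by simp [nestedDepth]⟩
    · simp [nestedDepth, hb] at hx

lemma RootedPart.dist_le {U V : Type*} {T : SimpleGraph U} {r : U} {G : SimpleGraph V} {φ : U → V}
    (H : RootedPart T r G φ) {h : U → ℕ} (hT : IsDepth T r h) (x : U) :
    G.dist (φ x) (φ r) ≤ h x := by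
  obtain ⟨p, hp⟩ := hT.exists_walk x
  let f : T →g G := ⟨φ, fun h => (H.adj_iff _ _).2 h⟩
  have := SimpleGraph.dist_le (p.map f)
  rwa [SimpleGraph.Walk.length_map, hp] at this

lemma isPendant_copy_copy {U : Type} {T : SimpleGraph U} {r : U} {h : U → ℕ} (hT : IsDepth T r h)
    {d : ℕ} (hd : ∀ x, h x ≤ d) (m n : ℕ) (b c : Bool) :
    IsPendant T r (joinGraph (joinGraph T r m) .root n) (fun x => .copy b (.copy c x))
      (.copy b .root) (nestedDepth h m n b c) (m + 1) d where
  part := ((RootedPart.refl _ _).copy b).copy c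
  base := by simp [nestedDepth, branchDepth]
  lip := by
    rintro (_ | ⟨b', j⟩ | ⟨b', x⟩) y hxy
    · obtain ⟨b', rfl⟩ := joinGraph_adj_root.1 hxy
      simp [nestedDepth_armVertex]
    · obtain rfl | rfl := joinGraph_adj_path.1 hxy <;> simp [nestedDepth_armVertex]
    · obtain ⟨z, hz, rfl⟩ | ⟨rfl, rfl⟩ := joinGraph_adj_copy.1 hxy
      · have := branchDepth_le_of_adj (b := c) hT hz
        simp only [nestedDepth]
        split_ifs <;> omega
      · simp [nestedDepth_armVertex]
  down x k hx := by
    obtain ⟨y, rfl, hy⟩ := exists_of_nestedDepth_ne_zero (by omega : nestedDepth h m n b c x ≠ 0)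
    obtain ⟨z, hz, hzk⟩ := exists_branchDepth_eq (b := c) hT (hy.symm.trans hx)
    exact ⟨_, joinGraph_adj_copy.2 (.inl ⟨z, hz, rfl⟩), by simpa [nestedDepth] using hzk⟩
  boundary x y hxy hx hy := by
    obtain ⟨x, rfl, hx'⟩ := exists_of_nestedDepth_ne_zero hx
    rw [hx'] at hx
    obtain ⟨z, hz, rfl⟩ | ⟨rfl, rfl⟩ := joinGraph_adj_copy.1 hxy
    · rw [eq_root_of_branchDepth_eq_zero hT hz hx (by simpa [nestedDepth] using hy)]
    · simp [branchDepth] at hx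
  core a := by simp [nestedDepth, branchDepth]
  height x := by
    by_cases h0 : nestedDepth h m n b c x = 0
    · omega
    · obtain ⟨y, -, hy⟩ := exists_of_nestedDepth_ne_zero h0
      rw [hy]
      rcases y with _ | ⟨b', j⟩ | ⟨b', y⟩ <;> simp only [branchDepth]
      · omega
      · have := j.2; split_ifs <;> omega
      · have := hd y; split_ifs <;> omega
  arm x y hxy h0 hm := by
    obtain ⟨x, rfl, hx⟩ := exists_of_nestedDepth_ne_zero h0.ne'
    obtain ⟨y, rfl, hy⟩ := exists_of_nestedDepth_ne_zero (by omega : nestedDepth h m n b c y ≠ 0)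
    rw [eq_of_branchDepth_eq (by omega : branchDepth h m c x = branchDepth h m c y) (by omega)
      (by omega)]
  dist_root a :=
    (RootedPart.dist_le (((RootedPart.refl _ _).copy b).copy c) hT a).trans (hd a)

lemma nestedDepth_eq_zero {V : Type} {h : V → ℕ} {m n : ℕ} {b c b' c' : Bool}
    {x : JoinVertex (JoinVertex V m) n} (hne : (b, c) ≠ (b', c'))
    (hx : nestedDepth h m n b c x ≠ 0) : nestedDepth h m n b' c' x = 0 := by
  obtain ⟨y, rfl, hy⟩ := exists_of_nestedDepth_ne_zero hx
  rw [hy] at hx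
  by_cases hb : b = b'
  · subst hb
    have hc : c ≠ c' := by simpa using hne
    rcases y with _ | ⟨c₁, j⟩ | ⟨c₁, y⟩ <;> simp only [nestedDepth, branchDepth] at hx ⊢ <;>
      split_ifs at hx ⊢ <;> simp_all
  · simp [nestedDepth, hb]

/-- Clearing `T_{i + 2}` takes more cops than clearing `T_i`. -/
theorem treeGraph_not_copClearable_succ {i k : ℕ} (hT : ¬ CopClearable (treeGraph (i + 1)) k) :
    ¬ CopClearable (treeGraph (i + 3)) (k + 1) := by
  refine not_copClearable_of_four_parts (l := internalCount (i + 1) + 1) (d := treeHeight (i + 1))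
    (fun b c => isPendant_copy_copy (isDepth_treeDepth (i + 1)) (treeDepth_le (i + 1))
      (internalCount (i + 1)) (internalCount (i + 2)) b c)
    (isDepth_treeDepth (i + 3)).connected
    (fun b c b' c' x hne hx => nestedDepth_eq_zero hne hx) (fun b b' c => ?_) ?_ hT
  · simp [nestedDepth, branchDepth]
  · have := five_mul_treeHeight_le i
    simp only [internalCount]
    omega

lemma not_copClearable_zero {V : Type*} [Nonempty V] (G : SimpleGraph V) : ¬ CopClearable G 0 := by
  rintro ⟨p, -, t, ht⟩
  obtain ⟨x⟩ := ‹Nonempty V›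
  have hx : ∀ s, x ∈ dirtyAfter G p s := fun s =>
    mem_dirtyAfter_of_le (mem_dirtyAfter_zero fun i => i.elim0) (Nat.zero_le s)
      fun _ _ _ i => i.elim0
  exact (ht ▸ hx t : x ∈ (∅ : Set V))

/-- The induction starts with no cops at all and uses two levels per cop. -/
theorem treeGraph_not_copClearable {i k : ℕ} (hk : 2 * k ≤ i) :
    ¬ CopClearable (treeGraph (i + 1)) k := by
  induction k generalizing i with
  | zero =>
    have : Nonempty (TreeVertex (i + 1)) := ⟨treeRoot _⟩
    exact not_copClearable_zero _
  | succ k ih =>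
    obtain ⟨i, rfl⟩ : ∃ j, i = j + 2 := ⟨i - 2, by omega⟩
    exact treeGraph_not_copClearable_succ (ih (by omega))

/-! ### Clearing the trees with two jumping lions -/

/-- The vertices of branch `b` of a join, without the root. -/
def OnBranch {V : Type} {m : ℕ} (b : Bool) (z : JoinVertex V m) : Prop :=
  (∃ j, z = .path b j) ∨ ∃ x, z = .copy b x

lemma eq_root_or_onBranch {V : Type} {m : ℕ} (z : JoinVertex V m) :
    z = .root ∨ OnBranch false z ∨ OnBranch true z := by
  rcases z with _ | ⟨b, j⟩ | ⟨b, x⟩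
  · exact .inl rfl
  · cases b
    · exact .inr (.inl (.inl ⟨j, rfl⟩))
    · exact .inr (.inr (.inl ⟨j, rfl⟩))
  · cases b
    · exact .inr (.inl (.inr ⟨x, rfl⟩))
    · exact .inr (.inr (.inr ⟨x, rfl⟩))

lemma onBranch_armVertex {V : Type} {r : V} {m : ℕ} (b : Bool) {j : ℕ} (hj : 0 < j) :
    OnBranch b (armVertex r m b j) := by
  unfold armVertex
  split_ifs with h0 h1
  · omega
  · exact .inl ⟨_, rfl⟩
  · exact .inr ⟨_, rfl⟩

lemma OnBranch.eq_armVertex_or_copy {V : Type} {m : ℕ} {b : Bool} {z : JoinVertex V m}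
    (hz : OnBranch b z) (r : V) :
    (∃ j, 0 < j ∧ j ≤ m ∧ z = armVertex r m b j) ∨ ∃ x, z = .copy b x := by
  obtain ⟨j, rfl⟩ | hx := hz
  · exact .inl ⟨j + 1, by omega, j.2, (armVertex_succ b j).symm⟩
  · exact .inr hx

lemma OnBranch.adj {V : Type} {G : SimpleGraph V} {r : V} {m : ℕ} {b : Bool} {z y : JoinVertex V m}
    (hz : OnBranch b z) (h : (joinGraph G r m).Adj z y) : OnBranch b y ∨ y = .root := by
  have key : ∀ j, OnBranch b (armVertex r m b j) ∨ armVertex r m b j = .root := fun j => by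
    rcases j.eq_zero_or_pos with rfl | hj
    · exact .inr (armVertex_zero b)
    · exact .inl (onBranch_armVertex b hj)
  obtain ⟨j, rfl⟩ | ⟨x, rfl⟩ := hz
  · obtain rfl | rfl := joinGraph_adj_path.1 h
    · exact key _
    · exact key _
  · obtain ⟨w, -, rfl⟩ | ⟨-, rfl⟩ := joinGraph_adj_copy.1 h
    · exact .inl (.inr ⟨w, rfl⟩)
    · exact key _

lemma RootedPart.exists_adj {U V : Type*} {T : SimpleGraph U} {r : U} {G : SimpleGraph V}
    {φ : U → V} (H : RootedPart T r G φ) {x : U} (hx : x ≠ r) {w : V} (h : G.Adj (φ x) w) :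
    ∃ y, w = φ y ∧ T.Adj x y := by
  obtain ⟨y, rfl⟩ := H.closed x w hx h
  exact ⟨y, rfl, (H.adj_iff x y).1 h⟩

lemma RootedPart.eq_of_retract_ne {U V : Type*} {T : SimpleGraph U} {r : U} {G : SimpleGraph V}
    {φ : U → V} (H : RootedPart T r G φ) {w : V} (h : H.retract w ≠ r) : w = φ (H.retract w) := by
  by_cases hw : ∃ y, w = φ y
  · obtain ⟨y, rfl⟩ := hw
    rw [H.retract_apply]
  · exact absurd (H.retract_of_notMem (by simpa using hw)) h

/-- Branch `b` of the join can be swept in `n` steps, starting from the root, whatever happens in the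
rest of the graph. -/
def BranchSweepable {U : Type} {m : ℕ} {V : Type*} (G : SimpleGraph V) (ψ : JoinVertex U m → V)
    (n : ℕ) (b : Bool) : Prop :=
  ∃ c, Sweep G n (ψ .root, ψ .root) c (fun e _ => ∀ z, OnBranch b z → e ≠ ψ z)

lemma branchSweepable_join {U : Type} {V : Type*} {T : SimpleGraph U} {r : U} {m₀ m n : ℕ}
    {h : JoinVertex U m₀ → ℕ} (hT : IsDepth (joinGraph T r m₀) .root h) {G : SimpleGraph V}
    {ψ : JoinVertex (JoinVertex U m₀) m → V}
    (H : RootedPart (joinGraph (joinGraph T r m₀) .root m) .root G ψ) (hm : n + 2 < m) (b : Bool)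
    (hsub : ∀ b', BranchSweepable G (fun x => ψ (.copy b x)) n b') :
    BranchSweepable G ψ (2 * (m + 1) + 2 * n + 3) b := by
  have HC := H.copy b
  set a : ℕ → V := fun j => ψ (armVertex .root m b j) with ha
  have ha0 : a 0 = ψ .root := congrArg ψ (armVertex_zero b)
  have haend : a (m + 1) = ψ (.copy b .root) := congrArg ψ (armVertex_last b)
  have hadj : ∀ j, j ≤ m → G.Adj (a j) (a (j + 1)) := fun j hj =>
    (H.adj_iff _ _).2 (joinGraph_adj_arm_succ b hj)
  have hnb : ∀ j, j < m → ∀ w, G.Adj (a (j + 1)) w → w = a j ∨ w = a (j + 2) := by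
    intro j hj w hw
    obtain ⟨y, rfl, hy⟩ := H.exists_adj (by simp [armVertex_eq_root_iff]) hw
    exact ((joinGraph_adj_arm hj).1 hy).imp (congrArg ψ) (congrArg ψ)
  obtain ⟨cF, sF⟩ := hsub false
  obtain ⟨cT, sT⟩ := hsub true
  simp only [← haend] at sT
  -- One lion guards the root; the other walks down the arm and drives the evaders of this branch
  -- into the copy.
  have first : Sweep G (m + 1) (a 0, a 0) (a 0, a (m + 1)) (fun e e' =>
      (∃ z, OnBranch b z ∧ e = ψ z) → ∃ x, e' = ψ (.copy b x)) := by
    refine (Sweep.push (K := {e | ∃ x, e = ψ (.copy b x)}) hadj hnb (.inl ⟨_, haend⟩) ?_).mono ?_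
    · rintro _ ⟨x, rfl⟩ w hw
      obtain ⟨y, rfl, hy⟩ := H.exists_adj (by simp) hw
      obtain ⟨z, -, rfl⟩ | ⟨rfl, rfl⟩ := joinGraph_adj_copy.1 hy
      · exact .inl ⟨z, rfl⟩
      · exact .inr (.inr ⟨haend.symm, rfl⟩)
    · rintro e e' he ⟨z, hz, rfl⟩
      refine he ?_
      obtain ⟨j, h1, h2, rfl⟩ | ⟨x, rfl⟩ := hz.eq_armVertex_or_copy .root
      · exact .inl ⟨j, h1, h2, rfl⟩
      · exact .inr ⟨x, rfl⟩
  set f : V → ℕ := fun w => m + 1 - branchDepth h m b (H.retract w) with hf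
  have hflip : ∀ x y, G.Adj x y → f y ≤ f x + 1 := by
    intro x y hxy
    simp only [hf]
    obtain h1 | h1 := H.retract_adj hxy
    · rw [h1]; omega
    · have := branchDepth_le_of_adj (b := b) hT h1.symm
      omega
  -- The lions jump to `cF` one after the other and run the sweep of sub-branch `false` backwards,
  -- which empties it. This takes `n + 2 < m` steps, so evaders that went up the arm are still at
  -- distance at least `2` from the unguarded root.
  have second : Sweep G (1 + 1 + n) (ψ .root, a (m + 1)) (a (m + 1), a (m + 1)) (fun e e' =>
      (∃ x, e = ψ (.copy b x)) → (∃ j, 1 < j ∧ j ≤ m ∧ e' = a j) ∨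
        ∃ x, OnBranch true x ∧ e' = ψ (.copy b x)) := by
    have s1 : Sweep G 1 (ψ .root, a (m + 1)) (cF.1, a (m + 1)) _ := .single (.inr (.inr rfl))
    have s2 : Sweep G 1 (cF.1, a (m + 1)) cF _ := .single (.inr (.inl rfl))
    rw [haend] at s1 s2 ⊢
    refine ((((s1.trans s2).trans sF.symm).lipschitz hflip).uncaught (by omega)).mono ?_
    rintro _ e' ⟨⟨⟨e₁, -, hF⟩, hfe⟩, hne, -⟩ ⟨x, rfl⟩
    have h0 : f (ψ (.copy b x)) = 0 := by
      simp only [hf, H.retract_apply, branchDepth, if_pos]; omega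
    have hpos : 2 ≤ branchDepth h m b (H.retract e') := by
      rw [h0] at hfe
      simp only [hf] at hfe
      omega
    have he' := H.eq_of_retract_ne (w := e') (by intro h1; rw [h1] at hpos; simp [branchDepth] at hpos)
    rw [he'] at hF hne ⊢
    generalize H.retract e' = z at hpos hF hne ⊢
    rcases z with _ | ⟨b', j⟩ | ⟨b', y⟩
    · simp [branchDepth] at hpos
    · simp only [branchDepth] at hpos
      split_ifs at hpos with hb
      · subst hb
        exact .inl ⟨j + 1, by omega, j.2, congrArg ψ (armVertex_succ b' j).symm⟩
      · omega
    · simp only [branchDepth] at hpos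
      split_ifs at hpos with hb
      · subst hb
        refine .inr ⟨y, ?_, rfl⟩
        obtain rfl | hy | hy := eq_root_or_onBranch y
        · exact absurd rfl hne
        · exact absurd rfl (hF y hy)
        · exact hy
      · omega
  have hK : ∀ y, OnBranch true y → ∀ w, G.Adj (ψ (.copy b y)) w →
      (∃ x, OnBranch true x ∧ w = ψ (.copy b x)) ∨ w = a (m + 1) := by
    intro y hy w hw
    obtain ⟨z, rfl, hz⟩ := HC.exists_adj
      (by obtain ⟨j, rfl⟩ | ⟨x, rfl⟩ := hy <;> simp) hw
    obtain h1 | rfl := hy.adj hz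
    · exact .inl ⟨z, h1, rfl⟩
    · exact .inr haend.symm
  -- One lion jumps back to the root, just ahead of these evaders; the other seals off sub-branch
  -- `true`.
  have third : Sweep G 1 (a (m + 1), a (m + 1)) (a (m + 1), a 0) (fun e e' =>
      ((∃ j, 1 < j ∧ j ≤ m ∧ e = a j) ∨ ∃ x, OnBranch true x ∧ e = ψ (.copy b x)) →
      ((∃ j, 0 < j ∧ j ≤ m ∧ e' = a j) ∨ ∃ x, OnBranch true x ∧ e' = ψ (.copy b x))) := by
    have hj : JumpStep G (a (m + 1), a (m + 1)) (a (m + 1), a 0) := .inr (.inl rfl)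
    refine (Sweep.single hj).mono ?_
    rintro e e' he (⟨j, h1, h2, rfl⟩ | ⟨x, hx, rfl⟩)
    · obtain rfl | h3 := he.move
      · exact .inl ⟨j, by omega, h2, rfl⟩
      · obtain ⟨j, rfl⟩ : ∃ j', j = j' + 1 := ⟨j - 1, by omega⟩
        obtain rfl | rfl := hnb j h2 _ h3
        · exact .inl ⟨j, by omega, by omega, rfl⟩
        · obtain rfl | h4 := h2.eq_or_lt
          · exact absurd rfl he.after_fst
          · exact .inl ⟨j + 2, by omega, by omega, rfl⟩
    · obtain rfl | h3 := he.move
      · exact .inr ⟨x, hx, rfl⟩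
      · obtain h4 | h4 := hK x hx _ h3
        · exact .inr h4
        · exact absurd h4 he.after_fst
  -- The arm is now closed at both ends, so a second push catches everyone on it.
  have fourth : Sweep G (m + 1) (a (m + 1), a 0) (a (m + 1), a (m + 1)) (fun e e' =>
      ((∃ j, 0 < j ∧ j ≤ m ∧ e = a j) ∨ e ∈ {e | ∃ x, OnBranch true x ∧ e = ψ (.copy b x)}) →
        e' ∈ {e | ∃ x, OnBranch true x ∧ e = ψ (.copy b x)}) := by
    refine Sweep.push hadj hnb (.inr rfl) ?_
    rintro _ ⟨y, hy, rfl⟩ w hw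
    obtain h1 | h1 := hK y hy w hw
    · exact .inl h1
    · exact .inr (.inl h1)
  rw [← ha0] at second
  have total := (((first.trans second).trans third).trans fourth).trans sT
  rw [ha0, show m + 1 + (1 + 1 + n) + 1 + (m + 1) + n = 2 * (m + 1) + 2 * n + 3 by omega] at total
  refine ⟨cT, total.mono ?_⟩
  rintro e e' ⟨e₄, ⟨e₃, ⟨e₂, ⟨e₁, h1, h2⟩, h3⟩, h4⟩, h5⟩ z hz rfl
  obtain ⟨x, hx, rfl⟩ := h4 (h3 (h2 (h1 ⟨z, hz, rfl⟩)))
  exact h5 x hx rfl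

theorem treeGraph_branchSweepable {V : Type*} {G : SimpleGraph V} (i : ℕ)
    {ψ : JoinVertex (TreeVertex i) (internalCount i) → V}
    (H : RootedPart (treeGraph (i + 1)) (treeRoot (i + 1)) G ψ) (b : Bool) :
    BranchSweepable G ψ (stepCount (i + 1)) b := by
  induction i generalizing b with
  | zero =>
    -- One lion jumps onto the leaf; an evader there can only flee to the root, where the other lion
    -- stays.
    have hj : JumpStep G (ψ .root, ψ .root) (ψ .root, ψ (.copy b ())) := .inr (.inl rfl)
    refine ⟨_, (Sweep.single hj).mono ?_⟩
    rintro e e' he z hz rfl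
    obtain ⟨j, -⟩ | ⟨x, rfl⟩ := hz
    · exact j.elim0
    · obtain h | h := he.move
      · exact he.after_snd h
      · obtain ⟨y, rfl, hy⟩ := H.exists_adj (fun h0 => by cases h0) h
        obtain ⟨w, hw, -⟩ | ⟨-, rfl⟩ := joinGraph_adj_copy.1 hy
        · exact hw
        · exact he.after_fst (congrArg ψ (armVertex_zero b))
  | succ i ih =>
    have := branchSweepable_join (n := stepCount (i + 1)) (isDepth_treeDepth (i + 1)) H
      (by simp only [internalCount]; omega) b
      (fun b' => ih (ψ := fun x => ψ (.copy b x)) (H.copy b) b')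
    -- The recursion `4 * t + 15` is the cost of a sweep with `n = t` and `m = t + 5`.
    rwa [show stepCount (i + 2) = 2 * (internalCount (i + 1) + 1) + 2 * stepCount (i + 1) + 3 by
      simp only [stepCount, internalCount]; omega]

/-- Two jumping lions can clear `T_{i + 1}`. -/
theorem treeGraph_exists_sweep (i : ℕ) :
    ∃ n c c', Sweep (treeGraph (i + 1)) n c c' (fun _ _ => False) := by
  have H := RootedPart.refl (treeGraph (i + 1)) (treeRoot (i + 1))
  obtain ⟨c, s⟩ := treeGraph_branchSweepable i (ψ := fun x => x) H false
  obtain ⟨c', s'⟩ := treeGraph_branchSweepable i (ψ := fun x => x) H true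
  have hpos : stepCount (i + 1) ≠ 0 := by cases i <;> simp [stepCount]
  -- The reversed sweep ends with both lions at the root and every survivor in branch `true`, ready
  -- for the second sweep.
  refine ⟨_, c, c', ((s.symm.uncaught hpos).trans s').mono ?_⟩
  rintro _ _ ⟨e, ⟨h1, h2, -⟩, h3⟩
  obtain h | h | h := eq_root_or_onBranch (V := TreeVertex i) (m := internalCount i) e
  · exact h2 h
  · exact h1 e h rfl
  · exact h3 e h rfl

/-! ### Lions on a graph with a universal vertex -/

section Cone

variable {V : Type} {G : SimpleGraph V}

lemma addUniversal_adj_some {x y : V} : (addUniversal G).Adj (some x) (some y) ↔ G.Adj x y := by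
  simp only [addUniversal, SimpleGraph.fromRel_adj]
  constructor
  · rintro ⟨-, (h | ⟨v, w, h, h1, h2⟩) | (h | ⟨v, w, h, h1, h2⟩)⟩
    · cases h
    · cases h1; cases h2; exact h
    · cases h
    · cases h1; cases h2; exact h.symm
  · intro h
    exact ⟨by simpa using h.ne, .inl (.inr ⟨x, y, h, rfl, rfl⟩)⟩

lemma addUniversal_adj_none (x : V) : (addUniversal G).Adj none (some x) := by
  simp [addUniversal, SimpleGraph.fromRel_adj]

lemma notMem_contaminated {V : Type*} {G : SimpleGraph V} {k : ℕ} {p : ℕ → Fin k → V} {t : ℕ} {x : V}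
    (hx : x ∈ contaminated G p t) (i : Fin k) : p t i ≠ x := by
  rintro rfl
  cases t with
  | zero => exact hx ⟨i, rfl⟩
  | succ t =>
    obtain ⟨-, h⟩ | ⟨h, -⟩ := hx
    · exact h ⟨i, rfl⟩
    · exact h ⟨i, rfl⟩

lemma contaminated_congr {V : Type*} (G : SimpleGraph V) {k : ℕ} {p q : ℕ → Fin k → V} {n : ℕ}
    (h : ∀ t ≤ n, p t = q t) : contaminated G p n = contaminated G q n := by
  induction n with
  | zero => simp only [contaminated, occupied, h 0 le_rfl]
  | succ n ih =>
    simp only [contaminated, occupied, lionMoves, ih fun t ht => h t (by omega), h n (by omega),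
      h (n + 1) le_rfl]

/-- Three lions are at the universal vertex and at the two vertices of `c`. -/
def LionsAt (q : Fin 3 → Option V) (c : V × V) : Prop :=
  ∃ σ : Equiv.Perm (Fin 3), q (σ 0) = none ∧ q (σ 1) = some c.1 ∧ q (σ 2) = some c.2

/-- A step of two jumping lions is realized by three lions, the jump leading through the universal
vertex. -/
lemma LionsAt.exists_step {q : Fin 3 → Option V} {c c' : V × V} (hq : LionsAt q c)
    (hc : JumpStep G c c') :
    ∃ q' : Fin 3 → Option V, LionsAt q' c' ∧
      (∀ i, q' i = q i ∨ (addUniversal G).Adj (q i) (q' i)) ∧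
      ∀ e e', G.Adj e e' → (e = c'.1 ∧ e' = c.1) ∨ (e = c'.2 ∧ e' = c.2) →
        ∃ i, q i = some e' ∧ q' i = some e := by
  obtain ⟨σ, h0, h1, h2⟩ := hq
  have hfin : ∀ P : Fin 3 → Prop, P (σ 0) → P (σ 1) → P (σ 2) → ∀ i, P i := by
    intro P p0 p1 p2 i
    obtain ⟨i, rfl⟩ := σ.surjective i
    fin_cases i
    · exact p0
    · exact p1
    · exact p2
  -- A jump that is needed is not along an edge, so no evader can swap places with the jumper and
  -- there is no crossing to block.
  by_cases hwalk : (c'.1 = c.1 ∨ G.Adj c.1 c'.1) ∧ (c'.2 = c.2 ∨ G.Adj c.2 c'.2)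
  · refine ⟨fun i => ![none, some c'.1, some c'.2] (σ.symm i), ⟨σ, by simp, by simp, by simp⟩,
      hfin _ ?_ ?_ ?_, ?_⟩
    · simp [h0]
    · simpa [h1, addUniversal_adj_some] using hwalk.1
    · simpa [h2, addUniversal_adj_some] using hwalk.2
    · rintro e e' - (⟨rfl, rfl⟩ | ⟨rfl, rfl⟩)
      · exact ⟨σ 1, h1, by simp⟩
      · exact ⟨σ 2, h2, by simp⟩
  · obtain h | h | h := hc
    · exact absurd h hwalk
    · refine ⟨fun i => ![some c'.2, some c'.1, none] (σ.symm i),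
        ⟨Equiv.swap 0 2 |>.trans σ, by simp, ?_, by simp⟩, hfin _ ?_ ?_ ?_, ?_⟩
      · simp [show Equiv.swap (0 : Fin 3) 2 1 = 1 by decide]
      · simpa [h0] using addUniversal_adj_none _
      · simp [h1, h]
      · simpa [h2] using (addUniversal_adj_none _).symm
      · rintro e e' he (⟨rfl, rfl⟩ | ⟨rfl, rfl⟩)
        · exact absurd h he.ne
        · exact absurd ⟨.inl h, .inr he.symm⟩ hwalk
    · refine ⟨fun i => ![some c'.1, none, some c'.2] (σ.symm i),
        ⟨Equiv.swap 0 1 |>.trans σ, by simp, by simp, ?_⟩, hfin _ ?_ ?_ ?_, ?_⟩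
      · simp [show Equiv.swap (0 : Fin 3) 1 2 = 2 by decide]
      · simpa [h0] using addUniversal_adj_none _
      · simpa [h1] using (addUniversal_adj_none _).symm
      · simp [h2, h]
      · rintro e e' he (⟨rfl, rfl⟩ | ⟨rfl, rfl⟩)
        · exact absurd ⟨.inr he.symm, .inl h⟩ hwalk
        · exact absurd h he.ne

/-- Every contaminated vertex is the end of the trajectory of an uncaught evader. -/
lemma Sweep.exists_lions {n : ℕ} {c c' : V × V} {R : V → V → Prop} (hs : Sweep G n c c' R) :
    ∃ p : ℕ → Fin 3 → Option V, IsTokenWalk (addUniversal G) p ∧ LionsAt (p n) c' ∧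
      ∀ x ∈ contaminated (addUniversal G) p n, ∃ e e', x = some e' ∧ R e e' := by
  induction hs with
  | refl c h =>
    refine ⟨fun _ => ![none, some c.1, some c.2], fun _ _ => .inl rfl,
      ⟨Equiv.refl _, rfl, rfl, rfl⟩, ?_⟩
    rintro (_ | x) hx
    · exact absurd rfl (notMem_contaminated hx 0)
    · exact ⟨x, x, rfl, h x⟩
  | @step n c c' c'' R R' hs hj h ih =>
    obtain ⟨p, hp, hat, hR⟩ := ih
    obtain ⟨q, hq, hpq, hcross⟩ := hat.exists_step hj
    obtain ⟨σ, h0, h1, h2⟩ := hat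
    obtain ⟨σ', h0', h1', h2'⟩ := id hq
    set p' : ℕ → Fin 3 → Option V := fun t => if t ≤ n then p t else q with hp'
    have hle : ∀ t ≤ n, p' t = p t := fun t ht => if_pos ht
    have hgt : ∀ t, n < t → p' t = q := fun t ht => if_neg (by omega)
    have hcont : contaminated (addUniversal G) p' n = contaminated (addUniversal G) p n :=
      contaminated_congr _ hle
    refine ⟨p', fun t i => ?_, by rwa [hgt _ n.lt_succ_self], ?_⟩
    · rcases lt_trichotomy t n with ht | rfl | ht
      · rw [hle t ht.le, hle (t + 1) ht]; exact hp t i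
      · rw [hle t le_rfl, hgt (t + 1) (by omega)]; exact hpq i
      · rw [hgt t ht, hgt (t + 1) (by omega)]; exact .inl rfl
    · intro x hx
      have hfree : ∀ i, q i ≠ x := fun i => hgt (n + 1) n.lt_succ_self ▸ notMem_contaminated hx i
      obtain ⟨e'', rfl⟩ : ∃ e, x = some e := by
        cases x with
        | none => exact absurd h0' (hfree _)
        | some e => exact ⟨e, rfl⟩
      have ha1 : e'' ≠ c''.1 := by rintro rfl; exact hfree _ h1'
      have ha2 : e'' ≠ c''.2 := by rintro rfl; exact hfree _ h2'
      obtain ⟨w, hw, hmove⟩ : ∃ w ∈ contaminated (addUniversal G) p' n, some e'' = w ∨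
          ((addUniversal G).Adj (some e'') w ∧ (some e'', w) ∉ lionMoves p' n) := by
        obtain ⟨hx, -⟩ | ⟨-, w, hw, hadj, hm, -⟩ := hx
        · exact ⟨_, hx, .inl rfl⟩
        · exact ⟨w, hw, .inr ⟨hadj, hm⟩⟩
      rw [hcont] at hw
      obtain ⟨e, e', rfl, he⟩ := hR w hw
      refine ⟨e, e'', rfl, h e e' e'' he ?_⟩
      have hb1 : e' ≠ c'.1 := by rintro rfl; exact notMem_contaminated hw _ h1
      have hb2 : e' ≠ c'.2 := by rintro rfl; exact notMem_contaminated hw _ h2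
      have hcr : ¬ ((e' = c''.1 ∧ e'' = c'.1) ∨ (e' = c''.2 ∧ e'' = c'.2)) := by
        intro hcr
        obtain heq | ⟨hadj, hm⟩ := hmove
        · cases heq
          obtain ⟨h3, -⟩ | ⟨h3, -⟩ := hcr
          · exact ha1 h3
          · exact ha2 h3
        · obtain ⟨i, hi, hi'⟩ := hcross e' e'' (addUniversal_adj_some.1 hadj).symm hcr
          refine hm ⟨i, ?_⟩
          rw [hle n le_rfl, hgt (n + 1) (by omega), hi, hi']
      exact
        { move := hmove.imp (fun h3 => by cases h3; rfl)
            fun h3 => (addUniversal_adj_some.1 h3.1).symm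
          before_fst := hb1
          before_snd := hb2
          after_fst := ha1
          after_snd := ha2
          cross_fst := fun h3 => hcr (.inl h3)
          cross_snd := fun h3 => hcr (.inr h3) }

lemma lionClearable_addUniversal {n : ℕ} {c c' : V × V}
    (hs : Sweep G n c c' (fun _ _ => False)) : LionClearable (addUniversal G) 3 := by
  obtain ⟨p, hp, -, h⟩ := hs.exists_lions
  refine ⟨p, hp, n, Set.eq_empty_iff_forall_notMem.2 fun x hx => ?_⟩
  obtain ⟨_, _, -, hf⟩ := h x hx
  exact hf

end Cone

/-! ### Comparison of the two games -/

section Compare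

variable {V : Type*}

/-- For the same walk `S_t ⊆ W_t`: when dirt spreads from `w` to `x`, both ends are free at time
`t`, so no token crosses that edge in this step. -/
lemma LionClearable.copClearable {G : SimpleGraph V} {k : ℕ} (h : LionClearable G k) :
    CopClearable G k := by
  obtain ⟨p, hp, t, ht⟩ := h
  refine ⟨p, hp, t, Set.subset_eq_empty ?_ ht⟩
  clear ht
  induction t with
  | zero => exact fun x hx => hx.2
  | succ t ih =>
    rintro x ⟨⟨hx, hx'⟩, hxo⟩
    obtain ⟨-, w, hw, hadj⟩ | hx := hx
    · refine .inr ⟨hxo, w, ih hw, hadj, ?_, ?_⟩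
      · rintro ⟨i, hi⟩
        exact hx' ⟨i, (congrArg Prod.fst hi).symm⟩
      · rintro ⟨i, hi⟩
        exact hw.2 ⟨i, (congrArg Prod.fst hi).symm⟩
    · exact .inl ⟨ih hx, hxo⟩

/-- A lion on every vertex. This makes the infima attained instead of being the default value of
`sInf ∅`. -/
lemma exists_lionClearable [Finite V] (G : SimpleGraph V) : ∃ k, LionClearable G k := by
  obtain ⟨k, ⟨e⟩⟩ := Finite.exists_equiv_fin V
  refine ⟨k, fun _ => e.symm, fun _ _ => .inl rfl, 0, ?_⟩
  simp [contaminated, occupied]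

lemma zeroVisibilityCopNumber_le_lionNumber [Finite V] (G : SimpleGraph V) :
    zeroVisibilityCopNumber G ≤ lionNumber G :=
  Nat.sInf_le (LionClearable.copClearable (Nat.sInf_mem (exists_lionClearable G)))

lemma copClearable_zeroVisibilityCopNumber [Finite V] (G : SimpleGraph V) :
    CopClearable G (zeroVisibilityCopNumber G) :=
  Nat.sInf_mem (s := {k | CopClearable G k})
    ((exists_lionClearable G).imp fun _ h => h.copClearable)

lemma CopClearable.of_iso {W : Type*} {G : SimpleGraph V} {G' : SimpleGraph W} {k : ℕ}
    (h : CopClearable G' k) (e : G ≃g G') : CopClearable G k := by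
  obtain ⟨p, hp, t, ht⟩ := h
  have hocc : ∀ s x, x ∈ occupied (fun s i => e.symm (p s i)) s ↔ e x ∈ occupied p s := by
    intro s x
    simp only [occupied, Set.mem_range]
    exact exists_congr fun i => by rw [RelIso.symm_apply_eq]
  have hd : ∀ s x, x ∈ dirtyBefore G (fun s i => e.symm (p s i)) s ↔ e x ∈ dirtyBefore G' p s := by
    intro s
    induction s with
    | zero => exact fun x => Iff.rfl
    | succ s ih =>
      intro x
      simp only [dirtyBefore, openNeighborhood, Set.mem_sdiff, Set.mem_union, Set.mem_ofPred_eq, hocc,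
        ih]
      refine and_congr_left fun _ => or_congr_left (and_congr_right fun _ => ?_)
      constructor
      · rintro ⟨y, hy, hxy⟩
        exact ⟨e y, hy, e.map_adj_iff.2 hxy⟩
      · rintro ⟨y, hy, hxy⟩
        obtain ⟨y, rfl⟩ := e.surjective y
        exact ⟨y, hy, e.map_adj_iff.1 hxy⟩
  refine ⟨fun s i => e.symm (p s i), fun s i => ?_, t, ?_⟩
  · exact (hp s i).imp (congrArg e.symm) e.symm.map_adj_iff.2
  · refine Set.eq_empty_iff_forall_notMem.2 fun x hx => ?_
    have : e x ∈ dirtyAfter G' p t := ⟨(hd t x).1 hx.1, fun h => hx.2 ((hocc t x).2 h)⟩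
    exact (ht ▸ this : e x ∈ (∅ : Set W))

end Compare

/-! ### The trees and their supergraphs -/

lemma four_le_of_copClearable {i k : ℕ} (hi : 13 ≤ i) (h : CopClearable (treeGraph i) k) :
    4 ≤ k := by
  by_contra hk
  obtain ⟨i, rfl⟩ : ∃ j, i = j + 1 := ⟨i - 1, by omega⟩
  exact treeGraph_not_copClearable (by omega) h

lemma lionNumber_coneGraph_le {i : ℕ} (hi : 1 ≤ i) : lionNumber (coneGraph i) ≤ 3 := by
  obtain ⟨i, rfl⟩ : ∃ j, i = j + 1 := ⟨i - 1, by omega⟩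
  obtain ⟨n, c, c', h⟩ := treeGraph_exists_sweep i
  exact Nat.sInf_le (lionClearable_addUniversal h)

/-- The inclusion of `T_i` into `G_i`. -/
def treeCopy (i : ℕ) : SimpleGraph.Copy (treeGraph i) (coneGraph i) :=
  ⟨⟨some, fun h => addUniversal_adj_some.2 h⟩, Option.some_injective _⟩

lemma coneGraph_connected (i : ℕ) : (coneGraph i).Connected := by
  have h : ∀ x, (coneGraph i).Reachable none x := by
    rintro (_ | x)
    · exact .refl _
    · exact (addUniversal_adj_none x).reachable
  exact { preconnected := fun x y => (h x).symm.trans (h y), nonempty := ⟨none⟩ }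

theorem mainTheorem10 :
    -- `c₀` is not monotone under subgraph inclusion, even for connected graphs and subgraphs
    (¬ ∀ (V : Type) [Finite V] (G : SimpleGraph V) (H : G.Subgraph),
      G.Connected → H.Connected →
        zeroVisibilityCopNumber H.coe ≤ zeroVisibilityCopNumber G) ∧
    -- `c₀ ≤ 𝓛` on all finite graphs
    (∀ (V : Type*) [Finite V] (G : SimpleGraph V),
      zeroVisibilityCopNumber G ≤ lionNumber G) ∧
    -- the explicit trees `T_i` and supergraphs `G_i`
    (∀ i : ℕ, 1 ≤ i →
      (treeGraph i).IsTree ∧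
      (treeGraph i).IsContained (coneGraph i) ∧
      lionNumber (coneGraph i) ≤ 3 ∧
      zeroVisibilityCopNumber (coneGraph i) ≤ 3) ∧
    (∀ i : ℕ, 13 ≤ i → 4 ≤ zeroVisibilityCopNumber (treeGraph i)) := by
  have hcone : ∀ i, 1 ≤ i → zeroVisibilityCopNumber (coneGraph i) ≤ 3 := fun i hi =>
    (zeroVisibilityCopNumber_le_lionNumber _).trans (lionNumber_coneGraph_le hi)
  refine ⟨fun hmono => ?_, fun V _ G => zeroVisibilityCopNumber_le_lionNumber G, fun i hi =>
    ⟨treeGraph_isTree i, ⟨treeCopy i⟩, lionNumber_coneGraph_le hi, hcone i hi⟩, fun i hi =>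
    four_le_of_copClearable hi (copClearable_zeroVisibilityCopNumber _)⟩
  have hiso := (treeCopy 13).isoToSubgraph
  have hH : (treeCopy 13).toSubgraph.Connected :=
    ⟨hiso.connected_iff.1 (treeGraph_isTree 13).connected⟩
  have h1 := hmono _ (coneGraph 13) (treeCopy 13).toSubgraph (coneGraph_connected 13) hH
  have h2 := hcone 13 (by omega)
  have h3 := four_le_of_copClearable le_rfl
    ((copClearable_zeroVisibilityCopNumber (treeCopy 13).toSubgraph.coe).of_iso hiso)
  omega
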